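/- Let $n\ge 2$, let $I\subseteq\mathbb R$ be an open interval and let $f$ be a smooth positive function on $I\cap(0,\infty)$. Consider the warped product space $$U=\{x\in\mathbb R^n:\ |x|\in I\},\qquad ds^2=\frac{1}{f(r)^2}\,dr^2+r^2\,dS_{n-1}^2,\qquad r=|x|,$$ where $dS_{n-1}^2$ is the standard metric of the unit sphere $S^{n-1}$; if $0\in I$, assume also that $ds^2$ (with the Euclidean inner product as its value at the origin) is smooth at the origin. For $r\in I$, $r>0$, let $S_r=\{|x|=r\}$ be the geodesic (slice) sphere of radius $r$, parametrized by $p\mapsto rp$, $p\in S^{n-1}$; its second fundamental form with respect to the outer unit normal $f\partial_r$ is $\frac{f(r)}{r}$ times its metric. For $k\in\mathbb N$ and $\delta>0$, an isometric convex $(k,\delta)$-perturbation of $S_r$ is a smooth embedding $Y:S^{n-1}\to U$ whose image is the boundary of a bounded open subset of $\mathbb R^n$, whose second fundamental form with respect to the outer unit normal is positive definite, which induces on $S^{n-1}$ the same metric as $p\mapsto rp$, and which is $\delta$-close to $p\mapsto rp$ in $C^k(S^{n-1})$. The sphere $S_r$ is called rigid if there are $k$ and $\delta>0$ such that every isometric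 convex $(k,\delta)$-perturbation of $S_r$ has the same second fundamental form as $S_r$. (1) If $r\in I$, $r>0$ and $$\frac{f(r)f'(r)}{r}+\frac{1-f(r)^2}{r^2}\neq 0,$$ then $S_r$ is not rigid: for every $k$ and every $\delta>0$ there is an isometric convex $(k,\delta)$-perturbation of $S_r$ whose second fundamental form is different from that of $S_r$. (2) If $S_r$ is rigid for every $r\in I$ with $r>0$, then the space is a space form: there is $\kappa\in\mathbb R$ such that $f(r)=\sqrt{1+\kappa r^2}$ for all $r\in I$, $r>0$, and $(U,ds^2)$ has constant sectional curvature $-\kappa$. -/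

import Mathlib

noncomputable section

namespace WarpedSpace

open scoped ContDiff Manifold RealInnerProductSpace
open Set Filter Topology Metric

/-- Euclidean space `ℝⁿ`. -/
abbrev E (n : ℕ) := EuclideanSpace ℝ (Fin n)

/-- The unit sphere `S^m` in `ℝ^(m+1)`, with its smooth manifold structure. -/
abbrev Sph (m : ℕ) := sphere (0 : E (m + 1)) 1

/-- A field of bilinear forms on (a subset of) `ℝⁿ`: `g x v w` is the value at `x` on `v, w`. -/
abbrev FormField (n : ℕ) := E n → E n → E n → ℝ

/-! ### Curvature of a metric in the coordinates of `ℝⁿ` -/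

/-- The coordinate vector `∂ᵢ`. -/
def coordVec {n : ℕ} (i : Fin n) : E n := EuclideanSpace.single i 1

/-- The matrix `g_ij(x)`. -/
def gram {n : ℕ} (g : FormField n) (x : E n) : Matrix (Fin n) (Fin n) ℝ :=
  Matrix.of fun i j => g x (coordVec i) (coordVec j)

/-- The partial derivative `∂ᵢ u (x)`. -/
def partialD {n : ℕ} (u : E n → ℝ) (x : E n) (i : Fin n) : ℝ :=
  fderiv ℝ u x (coordVec i)

/-- The Christoffel symbols of the Levi-Civita connection,
`Γ^k_ij = ½ ∑ₗ g^kl (∂ᵢ g_jl + ∂ⱼ g_il - ∂ₗ g_ij)`. -/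
def christoffel {n : ℕ} (g : FormField n) (x : E n) (k i j : Fin n) : ℝ :=
  (1 / 2) * ∑ l, (gram g x)⁻¹ k l *
    (partialD (fun y => gram g y j l) x i + partialD (fun y => gram g y i l) x j
      - partialD (fun y => gram g y i j) x l)

/-- The vector `Γ_x(v, w) = ∑ₖ (∑ᵢⱼ Γ^k_ij vⁱ wʲ) ∂ₖ`. -/
def christoffelVec {n : ℕ} (g : FormField n) (x v w : E n) : E n :=
  WithLp.toLp 2 fun k => ∑ i, ∑ j, christoffel g x k i j * v i * w j

/-- The components `R^l_kij` of the curvature tensor: `R(∂ᵢ, ∂ⱼ) ∂ₖ = ∑ₗ R^l_kij ∂ₗ`, where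
`R(X, Y) = D_X D_Y - D_Y D_X - D_[X,Y]`. -/
def curvatureSymbol {n : ℕ} (g : FormField n) (x : E n) (l k i j : Fin n) : ℝ :=
  partialD (fun y => christoffel g y l j k) x i - partialD (fun y => christoffel g y l i k) x j
    + ∑ a, (christoffel g x l i a * christoffel g x a j k
      - christoffel g x l j a * christoffel g x a i k)

/-- The vector `R_x(u, v) w`. -/
def curvatureVec {n : ℕ} (g : FormField n) (x u v w : E n) : E n :=
  WithLp.toLp 2 fun l => ∑ k, ∑ i, ∑ j, curvatureSymbol g x l k i j * u i * v j * w k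

/-- All sectional curvatures of the metric `g` at the points of `U` are equal to `K`. -/
def HasConstantSectionalCurvature {n : ℕ} (g : FormField n) (U : Set (E n)) (K : ℝ) : Prop :=
  ∀ x ∈ U, ∀ u v : E n,
    g x (curvatureVec g x u v v) u = K * (g x u u * g x v v - g x u v ^ 2)

/-! ### Warped product spaces -/

/-- The warped product metric `dr² / f(r)² + r² dS²` in the Cartesian coordinates of `ℝⁿ`: since
`dr(v) = ⟪x, v⟫ / ‖x‖` and `dr² + r² dS²` is the Euclidean metric, it is
`(1 / f(r)² - 1) dr² + (Euclidean metric)`, where `r = ‖x‖`. At `x = 0` the formula gives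
the Euclidean inner product. -/
def warpedMetric {n : ℕ} (f : ℝ → ℝ) : FormField n := fun x v w =>
  (1 / f ‖x‖ ^ 2 - 1) * ((⟪x, v⟫ / ‖x‖) * (⟪x, w⟫ / ‖x‖)) + ⟪v, w⟫

/-- The part `{x | ‖x‖ ∈ I}` of `ℝⁿ` on which the warped product metric lives. -/
def region (n : ℕ) (I : Set ℝ) : Set (E n) := {x | ‖x‖ ∈ I}

/-- `I` is an open interval (only `I ∩ [0, ∞)`, the range of the radius, matters), and `f` is a
smooth positive function of the radius `r > 0`, `r ∈ I`. If the origin belongs to the space, the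
metric is smooth there. -/
structure IsWarpingFunction (n : ℕ) (I : Set ℝ) (f : ℝ → ℝ) : Prop where
  isOpen : IsOpen I
  ordConnected : I.OrdConnected
  pos : ∀ r ∈ I, 0 < r → 0 < f r
  smooth : ContDiffOn ℝ ∞ f (I ∩ Ioi 0)
  smooth_origin : (0 : ℝ) ∈ I →
    ∀ v w : E n, ContDiffAt ℝ ∞ (fun x => warpedMetric f x v w) 0

/-! ### Hypersurfaces parametrized by the sphere -/

/-- The differential of a map `Y : S^m → ℝ^(m+1)`. -/
def differential {m : ℕ} (Y : Sph m → E (m + 1)) (p : Sph m) :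
    TangentSpace (𝓡 m) p →L[ℝ] E (m + 1) :=
  mfderiv (𝓡 m) 𝓘(ℝ, E (m + 1)) Y p

/-- The induced metric (first fundamental form) `dY · dY` on `S^m`. -/
def inducedMetric {m : ℕ} (g : FormField (m + 1)) (Y : Sph m → E (m + 1)) (p : Sph m)
    (v w : TangentSpace (𝓡 m) p) : ℝ :=
  g (Y p) (differential Y p v) (differential Y p w)

/-- The second fundamental form `h(v, w) = (D_v ν) · dY(w)` with respect to the unit normal `ν`,
where `D_v ν = dν(v) + Γ(dY(v), ν)` is the covariant derivative along `Y`. (For the outer normal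
spheres in Euclidean space have positive `h`.) -/
def secondFundamentalForm {m : ℕ} (g : FormField (m + 1)) (Y ν : Sph m → E (m + 1)) (p : Sph m)
    (v w : TangentSpace (𝓡 m) p) : ℝ :=
  g (Y p) (differential ν p v + christoffelVec g (Y p) (differential Y p v) (ν p))
    (differential Y p w)

/-- `Y` is a smooth embedding of `S^m` into the Riemannian space `(U, g)` as a closed strictly
convex hypersurface: it is the boundary of a bounded body `Ω ⊆ ℝ^(m+1)`, `ν` is its outer unit
normal, and its second fundamental form is positive definite. -/
structure IsConvexHypersurface {m : ℕ} (g : FormField (m + 1)) (U : Set (E (m + 1)))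
    (Y ν : Sph m → E (m + 1)) : Prop where
  mem : ∀ p, Y p ∈ U
  smooth : ContMDiff (𝓡 m) 𝓘(ℝ, E (m + 1)) ∞ Y
  injective : Function.Injective Y
  immersion : ∀ p, Function.Injective (differential Y p)
  smooth_normal : ContMDiff (𝓡 m) 𝓘(ℝ, E (m + 1)) ∞ ν
  unit_normal : ∀ p, g (Y p) (ν p) (ν p) = 1
  normal : ∀ p v, g (Y p) (ν p) (differential Y p v) = 0
  outer : ∃ Ω : Set (E (m + 1)), IsOpen Ω ∧ Bornology.IsBounded Ω ∧ frontier Ω = range Y ∧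
    ∀ p, ∀ᶠ t in 𝓝[>] (0 : ℝ), Y p + t • ν p ∉ closure Ω ∧ Y p - t • ν p ∈ Ω
  convex : ∀ p v, v ≠ 0 → 0 < secondFundamentalForm g Y ν p v v

/-- The geodesic sphere of radius `r`, as a map `S^m → ℝ^(m+1)`. -/
def slice {m : ℕ} (r : ℝ) : Sph m → E (m + 1) := fun p => r • (p : E (m + 1))

/-- The outer unit normal `f ∂_r` of the geodesic sphere of radius `r`. -/
def sliceNormal {m : ℕ} (f : ℝ → ℝ) (r : ℝ) : Sph m → E (m + 1) := fun p => f r • (p : E (m + 1))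

open Classical in
/-- The extension of a map on the unit sphere that is constant along rays (`0` at the origin). -/
def radialExt {m : ℕ} (F : Sph m → E (m + 1)) (x : E (m + 1)) : E (m + 1) :=
  if h : x ≠ 0 then F ⟨‖x‖⁻¹ • x, by simp [norm_smul, h]⟩ else 0

/-- `Y` and `Z` are `δ`-close in `C^k` on the sphere: all derivatives of order at most `k` of (the
extension, constant along rays, of) `Y - Z` are smaller than `δ` on the sphere. -/
def CkClose {m : ℕ} (k : ℕ) (δ : ℝ) (Y Z : Sph m → E (m + 1)) : Prop :=
  ∀ p : Sph m, ∀ j ≤ k,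
    ‖iteratedFDeriv ℝ j (radialExt fun q => Y q - Z q) (p : E (m + 1))‖ < δ

/-- `Y`, with outer unit normal `ν`, is a smooth strictly convex hypersurface of the warped product
space which is isometric to the geodesic sphere of radius `r`
and `δ`-close to this sphere in `C^k`. -/
def IsIsometricPerturbation {m : ℕ} (I : Set ℝ) (f : ℝ → ℝ) (r : ℝ) (k : ℕ) (δ : ℝ)
    (Y ν : Sph m → E (m + 1)) : Prop :=
  IsConvexHypersurface (warpedMetric f) (region (m + 1) I) Y ν ∧
  (∀ p v w, inducedMetric (warpedMetric f) Y p v w =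
    inducedMetric (warpedMetric f) (slice r) p v w) ∧
  CkClose k δ Y (slice r)

/-- `Y` has the same second fundamental form as the geodesic sphere of radius `r`. -/
def SameSecondForm {m : ℕ} (f : ℝ → ℝ) (r : ℝ) (Y ν : Sph m → E (m + 1)) : Prop :=
  ∀ p v w, secondFundamentalForm (warpedMetric f) Y ν p v w =
    secondFundamentalForm (warpedMetric f) (slice r) (sliceNormal f r) p v w

/-- The geodesic sphere of radius `r` is rigid: every smooth strictly convex hypersurface that is
isometric to it and sufficiently close to it has the same second fundamental form. -/
def SphereIsRigid (m : ℕ) (I : Set ℝ) (f : ℝ → ℝ) (r : ℝ) : Prop :=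
  ∃ k : ℕ, ∃ δ > 0, ∀ Y ν : Sph m → E (m + 1),
    IsIsometricPerturbation I f r k δ Y ν → SameSecondForm f r Y ν

end WarpedSpace

end

/-! The slice is deformed among hypersurfaces of revolution. With an axis `e` and `t = ⟪x, e⟫`, put
`Y(x) = r x + w(t) e`: every point keeps its distance from the axis and is shifted along it. Away
from the origin the warped metric is `dx² + G(|x|²)(x · dx)²`, and `Y` induces `r²` times the round
metric as soon as `w` solves `ProfileEq` on `[-1, 1]`. This equation is quadratic in `w'`. The root
that vanishes for `w = 0` gives an ODE `w' = Φ(t, w)` that is smooth near `w = 0` up to the poles `t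
= ±1`, because the height `t` is used instead of arc length; as a function of `⟪x, e⟫`, the shift is
smooth on the sphere.

Since `w = 0` is a solution, small initial values `w(-1) = ε ≠ 0` give nonzero solutions with all
derivatives up to any given order small (`exists_small_solution`). Smallness yields closeness in
`C^k` (`exists_ckClose`), an enclosed body (`exists_body`) and convexity (`exists_small_convex`).

The second fundamental form detects the deformation at the pole `-e`. There it is a multiple of the
round metric, and the square of the factor is given by a Gauss equation (`secondFormCoeff_sq`) in
terms of `(f² - 1)/ρ²` at `ρ = r - w(-1)`. Equal second fundamental forms would give this function
the same value at `ρ` and at `r`. Its derivative at `r` is `2/r` times the quantity assumed nonzero,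
so this is impossible for `ρ ≠ r` close to `r`.

If all slices are rigid, then `(f² - 1)/ρ²` is a constant `κ`. Then `G = -κ/(1 + κ q)`, the
Christoffel symbols are `-κ xᵏ g_ij`, and the curvature is `-κ`. -/

open scoped ContDiff Manifold RealInnerProductSpace
open Set Filter Topology Metric

noncomputable section

namespace WarpedSpace

/-! ### Metrics of the form `dx² + G(|x|²) (x · dx)²` -/

/-- The metric `dx² + G(|x|²) (x · dx)²` on `ℝⁿ`. -/
def radialForm {n : ℕ} (G : ℝ → ℝ) : FormField n := fun x v w =>
  ⟪v, w⟫ + G (‖x‖ ^ 2) * (⟪x, v⟫ * ⟪x, w⟫)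

section Christoffel

variable {n : ℕ} {G : ℝ → ℝ} {g : FormField n} {x : E n}

lemma inner_coordVec (x : E n) (i : Fin n) : ⟪x, coordVec i⟫ = x i := by
  simp [coordVec, EuclideanSpace.inner_single_right]

lemma coordVec_apply (i j : Fin n) : (coordVec i : E n) j = if i = j then 1 else 0 := by
  simp [coordVec, eq_comm]

lemma inner_eq_sum (v w : E n) : ⟪v, w⟫ = ∑ i, v i * w i := by
  simp [PiLp.inner_apply, mul_comm]

lemma gram_radialForm (G : ℝ → ℝ) (x : E n) (i j : Fin n) :
    gram (radialForm G) x i j = (if i = j then 1 else 0) + G (‖x‖ ^ 2) * (x i * x j) := by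
  simp only [gram, radialForm, Matrix.of_apply, inner_coordVec, coordVec_apply]

lemma partialD_eq_of_eventuallyEq {u w : E n → ℝ} (h : u =ᶠ[𝓝 x] w) (i : Fin n) :
    partialD u x i = partialD w x i := by
  rw [partialD, partialD, h.fderiv_eq]

lemma partialD_gram {G' : ℝ} (hG : HasDerivAt G G' (‖x‖ ^ 2))
    (hg : ∀ᶠ y in 𝓝 x, g y = radialForm G y) (i j l : Fin n) :
    partialD (fun y => gram g y i j) x l = 2 * G' * x l * x i * x j
      + G (‖x‖ ^ 2) * ((if l = i then x j else 0) + (if l = j then x i else 0)) := by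
  have h0 : (fun y => gram g y i j) =ᶠ[𝓝 x]
      fun y => (if i = j then 1 else 0) + G (‖y‖ ^ 2) * (y i * y j) := by
    filter_upwards [hg] with y hy
    rw [← gram_radialForm, gram, gram, Matrix.of_apply, Matrix.of_apply, hy]
  rw [partialD_eq_of_eventuallyEq h0]
  have hi : ∀ i : Fin n, HasFDerivAt (fun y : E n => y i)
      (EuclideanSpace.proj i : E n →L[ℝ] ℝ) x := fun i =>
    (EuclideanSpace.proj i : E n →L[ℝ] ℝ).hasFDerivAt
  have hn := (hasStrictFDerivAt_norm_sq x).hasFDerivAt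
  have h1 := ((hG.comp_hasFDerivAt x hn).mul ((hi i).mul (hi j))).const_add
    (if i = j then (1 : ℝ) else 0)
  have h2 : HasFDerivAt (fun y : E n => (if i = j then 1 else 0) + G (‖y‖ ^ 2) * (y i * y j))
    _ x := h1
  rw [partialD, h2.fderiv]
  simp [inner_coordVec, coordVec_apply]
  split_ifs <;> ring

/-- The Gram matrix is a rank-one perturbation of the identity, inverted by the Sherman–Morrison
formula. -/
lemma gram_inv (hG : 1 + G (‖x‖ ^ 2) * ‖x‖ ^ 2 ≠ 0) (i j : Fin n) :
    (gram (radialForm G) x)⁻¹ i j = (if i = j then 1 else 0)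
      - G (‖x‖ ^ 2) / (1 + G (‖x‖ ^ 2) * ‖x‖ ^ 2) * (x i * x j) := by
  set c := G (‖x‖ ^ 2) with hc
  have hq : ∑ k, x k * x k = ‖x‖ ^ 2 := by
    rw [← inner_eq_sum, real_inner_self_eq_norm_sq]
  have key : gram (radialForm G) x * Matrix.of (fun i j => (if i = j then (1 : ℝ) else 0)
      - c / (1 + c * ‖x‖ ^ 2) * (x i * x j)) = 1 := by
    ext i j
    rw [Matrix.mul_apply, Matrix.one_apply]
    simp only [gram_radialForm, Matrix.of_apply, ← hc]
    have : ∀ k, ((if i = k then (1 : ℝ) else 0) + c * (x i * x k)) *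
        ((if k = j then 1 else 0) - c / (1 + c * ‖x‖ ^ 2) * (x k * x j)) =
        (if i = k then ((if k = j then (1 : ℝ) else 0)
          - c / (1 + c * ‖x‖ ^ 2) * (x k * x j)) else 0)
        + (if k = j then c * (x i * x k) else 0)
        - c * x i * x j * (c / (1 + c * ‖x‖ ^ 2)) * (x k * x k) := by
      intro k
      split_ifs <;> ring
    simp only [this, Finset.sum_sub_distrib, Finset.sum_add_distrib, ← Finset.mul_sum, hq]
    simp
    field_simp
    ring
  rw [Matrix.inv_eq_right_inv key, Matrix.of_apply]

/-- In the Christoffel combination of derivatives all terms without a factor `x l` cancel. What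
remains is a multiple of `x`, an eigenvector of the inverse Gram matrix with eigenvalue `1 / (1 + G
‖x‖²)`. -/
lemma christoffel_eq {G' : ℝ} (hG : HasDerivAt G G' (‖x‖ ^ 2))
    (hg : ∀ᶠ y in 𝓝 x, g y = radialForm G y)
    (h0 : 1 + G (‖x‖ ^ 2) * ‖x‖ ^ 2 ≠ 0) (k i j : Fin n) :
    christoffel g x k i j = x k * (G' * (x i * x j) + G (‖x‖ ^ 2) * (if i = j then 1 else 0))
      / (1 + G (‖x‖ ^ 2) * ‖x‖ ^ 2) := by
  have hgx : gram g x = gram (radialForm G) x := by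
    ext i j
    rw [gram, gram, Matrix.of_apply, Matrix.of_apply, hg.self_of_nhds]
  simp only [christoffel, partialD_gram hG hg, hgx, gram_inv h0]
  set c := G (‖x‖ ^ 2) with hc
  have hq : ∑ k, x k * x k = ‖x‖ ^ 2 := by
    rw [← inner_eq_sum, real_inner_self_eq_norm_sq]
  have : ∀ l, ((if k = l then (1 : ℝ) else 0) - c / (1 + c * ‖x‖ ^ 2) * (x k * x l)) *
      (2 * G' * x i * x j * x l + c * ((if i = j then x l else 0) + (if i = l then x j else 0))
        + (2 * G' * x j * x i * x l
          + c * ((if j = i then x l else 0) + (if j = l then x i else 0)))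
        - (2 * G' * x l * x i * x j
          + c * ((if l = i then x j else 0) + (if l = j then x i else 0)))) =
      (if k = l then 2 * (G' * (x i * x j) + c * (if i = j then 1 else 0)) * x l else 0)
      - c / (1 + c * ‖x‖ ^ 2) * x k * 2 * (G' * (x i * x j) + c * (if i = j then 1 else 0))
        * (x l * x l) := by
    intro l
    simp only [eq_comm (a := l), eq_comm (a := j) (b := i)]
    split_ifs <;> ring
  simp only [this, Finset.sum_sub_distrib, ← Finset.mul_sum, hq]
  simp
  field_simp
  ring

lemma christoffelVec_eq {G' : ℝ} (hG : HasDerivAt G G' (‖x‖ ^ 2))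
    (hg : ∀ᶠ y in 𝓝 x, g y = radialForm G y)
    (h0 : 1 + G (‖x‖ ^ 2) * ‖x‖ ^ 2 ≠ 0) (v w : E n) :
    christoffelVec g x v w = ((G' * (⟪x, v⟫ * ⟪x, w⟫) + G (‖x‖ ^ 2) * ⟪v, w⟫)
      / (1 + G (‖x‖ ^ 2) * ‖x‖ ^ 2)) • x := by
  ext k
  simp only [christoffelVec, christoffel_eq hG hg h0, PiLp.smul_apply, smul_eq_mul]
  rw [inner_eq_sum x v, inner_eq_sum x w, inner_eq_sum v w, Finset.sum_mul_sum, Finset.mul_sum,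
    Finset.mul_sum, ← Finset.sum_add_distrib, Finset.sum_div, Finset.sum_mul]
  refine Finset.sum_congr rfl fun i _ => ?_
  have : ∀ j, x k * (G' * (x i * x j) + G (‖x‖ ^ 2) * (if i = j then 1 else 0))
      / (1 + G (‖x‖ ^ 2) * ‖x‖ ^ 2) * v i * w j =
      x k / (1 + G (‖x‖ ^ 2) * ‖x‖ ^ 2) * G' * (x i * v i * (x j * w j))
      + if i = j then x k / (1 + G (‖x‖ ^ 2) * ‖x‖ ^ 2) * G (‖x‖ ^ 2) * v i * w j else 0 := by
    intro j
    split_ifs <;> ring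
  simp only [this, Finset.sum_add_distrib, ← Finset.mul_sum]
  simp
  ring

lemma radialForm_christoffelVec {G' : ℝ} (hG : HasDerivAt G G' (‖x‖ ^ 2))
    (hg : ∀ᶠ y in 𝓝 x, g y = radialForm G y)
    (h0 : 1 + G (‖x‖ ^ 2) * ‖x‖ ^ 2 ≠ 0) (u v w : E n) :
    radialForm G x (christoffelVec g x v w) u =
      (G' * (⟪x, v⟫ * ⟪x, w⟫) + G (‖x‖ ^ 2) * ⟪v, w⟫) * ⟪x, u⟫ := by
  rw [christoffelVec_eq hG hg h0, radialForm, real_inner_smul_left, real_inner_smul_right,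
    real_inner_self_eq_norm_sq]
  rw [mul_comm (G _)] at h0 ⊢
  field_simp

end Christoffel

/-! ### Space forms -/

/-- The function `G` for which `dx² + G(|x|²) (x · dx)²` has constant curvature `-κ`. -/
def spaceFormCoeff (κ : ℝ) : ℝ → ℝ := fun q => -κ / (1 + κ * q)

/-- The Riccati equation `G' = G²` turns `G' xᵢ xⱼ + G δᵢⱼ` into `G g_ij`, so that the Christoffel
symbols become multiples of the metric. -/
lemma hasDerivAt_spaceFormCoeff {κ q : ℝ} (h : 1 + κ * q ≠ 0) :
    HasDerivAt (spaceFormCoeff κ) (spaceFormCoeff κ q ^ 2) q := by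
  have h1 : HasDerivAt (fun q => 1 + κ * q) κ q := by
    simpa using ((hasDerivAt_id q).const_mul κ).const_add 1
  have h2 : HasDerivAt (spaceFormCoeff κ) _ q := (h1.inv h).const_mul (-κ)
  refine h2.congr_deriv ?_
  simp only [spaceFormCoeff]
  field_simp

section SpaceForm

variable {n : ℕ} {κ : ℝ} {g : FormField n} {U : Set (E n)} {x : E n}

lemma christoffel_spaceForm (hU : IsOpen U) (hg : ∀ y ∈ U, g y = radialForm (spaceFormCoeff κ) y)
    (hκ : ∀ y ∈ U, 1 + κ * ‖y‖ ^ 2 ≠ 0) (hx : x ∈ U) (k i j : Fin n) :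
    christoffel g x k i j = -κ * (x k * gram g x i j) := by
  have h1 := hκ x hx
  have hgx : gram g x = gram (radialForm (spaceFormCoeff κ)) x := by
    ext i j
    rw [gram, gram, Matrix.of_apply, Matrix.of_apply, hg x hx]
  have h2 : 1 + spaceFormCoeff κ (‖x‖ ^ 2) * ‖x‖ ^ 2 = 1 / (1 + κ * ‖x‖ ^ 2) := by
    rw [spaceFormCoeff]
    field_simp
    ring
  rw [christoffel_eq (hasDerivAt_spaceFormCoeff h1) (eventually_of_mem (hU.mem_nhds hx) hg)
    (by rw [h2]; positivity), h2, hgx, gram_radialForm]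
  simp only [spaceFormCoeff]
  field_simp
  ring

/-- For `Γ^l_jk = -κ x_l g_jk`, differentiating the factor `x_l` produces the right-hand side; the
derivatives of the metric cancel against the quadratic terms. -/
lemma curvatureSymbol_spaceForm (hU : IsOpen U)
    (hg : ∀ y ∈ U, g y = radialForm (spaceFormCoeff κ) y)
    (hκ : ∀ y ∈ U, 1 + κ * ‖y‖ ^ 2 ≠ 0) (hx : x ∈ U) (l k i j : Fin n) :
    curvatureSymbol g x l k i j = -κ * ((if i = l then 1 else 0) * gram g x j k
      - (if j = l then 1 else 0) * gram g x i k) := by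
  have h1 := hκ x hx
  have hG := hasDerivAt_spaceFormCoeff h1
  have hev : ∀ᶠ y in 𝓝 x, g y = radialForm (spaceFormCoeff κ) y :=
    eventually_of_mem (hU.mem_nhds hx) hg
  have hgram : ∀ i j, gram g x i j = (if i = j then 1 else 0)
      + spaceFormCoeff κ (‖x‖ ^ 2) * (x i * x j) := by
    intro i j
    rw [← gram_radialForm, gram, gram, Matrix.of_apply, Matrix.of_apply, hg x hx]
  have hd : ∀ j k, DifferentiableAt ℝ (fun y => gram g y j k) x := by
    intro j k
    have h0 : (fun y => gram g y j k) =ᶠ[𝓝 x]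
        fun y => (if j = k then 1 else 0) + spaceFormCoeff κ (‖y‖ ^ 2) * (y j * y k) := by
      filter_upwards [hev] with y hy
      rw [← gram_radialForm, gram, gram, Matrix.of_apply, Matrix.of_apply, hy]
    refine DifferentiableAt.congr_of_eventuallyEq ?_ h0
    have hn : DifferentiableAt ℝ (fun y : E n => spaceFormCoeff κ (‖y‖ ^ 2)) x :=
      DifferentiableAt.comp (g := spaceFormCoeff κ) x hG.differentiableAt
        (hasStrictFDerivAt_norm_sq x).hasFDerivAt.differentiableAt
    fun_prop
  have hp : ∀ i j k, partialD (fun y => christoffel g y l j k) x i =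
      -κ * ((if i = l then 1 else 0) * gram g x j k
        + x l * partialD (fun y => gram g y j k) x i) := by
    intro i j k
    have h0 : (fun y => christoffel g y l j k) =ᶠ[𝓝 x] fun y => -κ * (y l * gram g y j k) :=
      eventually_of_mem (hU.mem_nhds hx) fun y hy => christoffel_spaceForm hU hg hκ hy l j k
    rw [partialD_eq_of_eventuallyEq h0, partialD, partialD]
    have h3 : HasFDerivAt (fun y : E n => -κ * (y l * gram g y j k)) _ x :=
      (((EuclideanSpace.proj l : E n →L[ℝ] ℝ).hasFDerivAt (x := x)).mul
        (hd j k).hasFDerivAt).const_mul (-κ)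
    rw [h3.fderiv]
    simp [coordVec_apply]
    split_ifs <;> ring
  have hq : ∑ k, x k * x k = ‖x‖ ^ 2 := by
    rw [← inner_eq_sum, real_inner_self_eq_norm_sq]
  simp only [curvatureSymbol, hp, partialD_gram hG hev, christoffel_spaceForm hU hg hκ hx, hgram]
  set c := spaceFormCoeff κ (‖x‖ ^ 2) with hc
  have hsum : ∀ a, -κ * (x l * ((if i = a then 1 else 0) + c * (x i * x a))) *
        (-κ * (x a * ((if j = k then 1 else 0) + c * (x j * x k)))) -
      -κ * (x l * ((if j = a then 1 else 0) + c * (x j * x a))) *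
        (-κ * (x a * ((if i = k then 1 else 0) + c * (x i * x k)))) =
      (if i = a then κ ^ 2 * x l * x a * ((if j = k then 1 else 0) + c * (x j * x k)) else 0)
      - (if j = a then κ ^ 2 * x l * x a * ((if i = k then 1 else 0) + c * (x i * x k)) else 0)
      + κ ^ 2 * x l * c * (x i * (if j = k then 1 else 0) - x j * (if i = k then 1 else 0))
        * (x a * x a) := by
    intro a
    split_ifs <;> ring
  simp only [hsum, Finset.sum_add_distrib, Finset.sum_sub_distrib, ← Finset.mul_sum, hq]
  simp only [Finset.sum_ite_eq, Finset.mem_univ, if_true]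
  have hc' : c * (1 + κ * ‖x‖ ^ 2) = -κ := by
    rw [hc, spaceFormCoeff]
    field_simp
  have hc2 : κ ^ 2 * (c * ‖x‖ ^ 2) = -κ * c - κ ^ 2 := by linear_combination κ * hc'
  simp only [eq_comm (a := j) (b := i)]
  have hm : ∀ (i j : Fin n) (a : ℝ), (if i = j then a else 0) = (if i = j then 1 else 0) * a := by
    intro i j a
    split_ifs <;> ring
  rw [hm i k (x j), hm j k (x i)]
  linear_combination (x l * (x i * (if j = k then 1 else 0) - x j * (if i = k then 1 else 0))) * hc2

lemma curvatureVec_spaceForm (hU : IsOpen U)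
    (hg : ∀ y ∈ U, g y = radialForm (spaceFormCoeff κ) y)
    (hκ : ∀ y ∈ U, 1 + κ * ‖y‖ ^ 2 ≠ 0) (hx : x ∈ U) (u v w : E n) :
    curvatureVec g x u v w = -κ • (g x v w • u - g x u w • v) := by
  have hb : ∀ v w : E n, g x v w = ∑ j, ∑ k, gram g x j k * v j * w k := by
    intro v w
    have hgram : ∀ i j, gram g x i j = (if i = j then 1 else 0)
        + spaceFormCoeff κ (‖x‖ ^ 2) * (x i * x j) := by
      intro i j
      rw [← gram_radialForm, gram, gram, Matrix.of_apply, Matrix.of_apply, hg x hx]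
    rw [hg x hx, radialForm, inner_eq_sum v w, inner_eq_sum x v, inner_eq_sum x w,
      Finset.sum_mul_sum, Finset.mul_sum, ← Finset.sum_add_distrib]
    refine Finset.sum_congr rfl fun j _ => ?_
    simp only [hgram, add_mul, Finset.sum_add_distrib, Finset.mul_sum]
    congr 1
    · simp
    · exact Finset.sum_congr rfl fun k _ => by ring
  ext l
  simp only [curvatureVec, curvatureSymbol_spaceForm hU hg hκ hx, PiLp.smul_apply,
    PiLp.sub_apply, smul_eq_mul, hb]
  have : ∀ k i j, -κ * ((if i = l then 1 else 0) * gram g x j k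
      - (if j = l then 1 else 0) * gram g x i k) * u i * v j * w k =
      (if i = l then -κ * (gram g x j k * v j * w k * u i) else 0)
      - (if j = l then -κ * (gram g x i k * u i * w k * v j) else 0) := by
    intro k i j
    split_ifs <;> ring
  simp only [this]
  simp only [Finset.sum_sub_distrib, Finset.sum_ite_irrel, Finset.sum_const_zero,
    Finset.sum_ite_eq', Finset.mem_univ, if_true, mul_sub, Finset.sum_mul, Finset.mul_sum]
  rw [Finset.sum_comm, Finset.sum_comm (f := fun k i => -κ * (gram g x i k * u i * w k * v l))]

lemma hasConstantSectionalCurvature_spaceForm (hU : IsOpen U)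
    (hg : ∀ y ∈ U, g y = radialForm (spaceFormCoeff κ) y)
    (hκ : ∀ y ∈ U, 1 + κ * ‖y‖ ^ 2 ≠ 0) : HasConstantSectionalCurvature g U (-κ) := by
  intro x hx u v
  rw [curvatureVec_spaceForm hU hg hκ hx, hg x hx]
  simp only [radialForm, real_inner_smul_left, real_inner_smul_right, inner_sub_left,
    inner_sub_right, real_inner_comm v u]
  ring

end SpaceForm

/-! ### Small solutions of an ordinary differential equation with the solution zero -/

/-- Multiplication by a cutoff function. The last clause keeps the zeros of `Φ`, so the zero
solution survives the truncation. -/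
lemma exists_compactly_supported_extension {F : Type*} [NormedAddCommGroup F] [NormedSpace ℝ F]
    [FiniteDimensional ℝ F] {Φ : F → ℝ} {V K : Set F} (hV : IsOpen V) (hΦ : ContDiffOn ℝ ∞ Φ V)
    (hK : IsCompact K) (hKV : K ⊆ V) :
    ∃ Ψ : F → ℝ, ContDiff ℝ ∞ Ψ ∧ HasCompactSupport Ψ ∧ (∀ᶠ z in 𝓝ˢ K, Ψ z = Φ z) ∧
      ∀ z, (z ∈ V → Φ z = 0) → Ψ z = 0 := by
  obtain ⟨L, hL, hKL, hLV⟩ := exists_compact_between hK hV hKV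
  obtain ⟨χ, h1, h0, -⟩ := exists_contMDiffMap_one_nhds_of_subset_interior (n := (⊤ : ℕ∞))
    𝓘(ℝ, F) hK.isClosed hKL
  have hχ : ContDiff ℝ ∞ χ := χ.contMDiff.contDiff
  refine ⟨fun z => χ z * Φ z, ?_, HasCompactSupport.intro hL fun z hz => by simp [h0 z hz], ?_, ?_⟩
  · rw [contDiff_iff_contDiffAt]
    intro z
    by_cases hz : z ∈ V
    · exact hχ.contDiffAt.mul (hΦ.contDiffAt (hV.mem_nhds hz))
    · have : (fun z => χ z * Φ z) =ᶠ[𝓝 z] fun _ => 0 := by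
        filter_upwards [hL.isClosed.isOpen_compl.mem_nhds fun h => hz (hLV h)] with y hy
        simp [h0 y hy]
      exact contDiffAt_const.congr_of_eventuallyEq this
  · filter_upwards [h1] with z hz
    simp [hz]
  · intro z hz
    by_cases h : z ∈ V
    · simp [hz h]
    · simp [h0 z fun h' => h (hLV h')]

section ODE

variable {Ψ : ℝ × ℝ → ℝ}

/-- Picard–Lindelöf with Lipschitz dependence on the initial value; comparison with the zero
solution gives the bound `C * |ε|`. -/
lemma exists_solution (hΨ : ContDiff ℝ ∞ Ψ) (hc : HasCompactSupport Ψ)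
    (h0 : ∀ t, Ψ (t, 0) = 0) {t₀ T : ℝ} (ht : t₀ ∈ Ioo (-T) T)
    (hT : ∀ t, t ∉ Icc (-T) T → ∀ y, Ψ (t, y) = 0) :
    ∃ C : ℝ, 0 ≤ C ∧ ∀ ε : ℝ, |ε| ≤ 1 → ∃ w : ℝ → ℝ, w t₀ = ε ∧
      (∀ t, HasDerivAt w (Ψ (t, w t)) t) ∧ ∀ t ∈ Icc (-T) T, |w t| ≤ C * |ε| := by
  obtain ⟨K, hK⟩ := hΨ.lipschitzWith_of_hasCompactSupport hc (by simp)
  obtain ⟨L, hL⟩ := hc.exists_bound_of_continuous hΨ.continuous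
  have hL0 : 0 ≤ L := (norm_nonneg _).trans (hL 0)
  have hKt : ∀ t, LipschitzWith K fun y => Ψ (t, y) := by
    intro t
    have := hK.comp (LipschitzWith.prodMk_left t)
    rwa [mul_one] at this
  have hle : -T ≤ T := by linarith [ht.1, ht.2]
  -- With speed at most `L`, a solution moves by at most `L * 2T` during the interval; the
  -- additional `1` leaves room for the initial values `|ε| ≤ 1`.
  have hpl : IsPicardLindelof (fun t y => Ψ (t, y)) (⟨t₀, Ioo_subset_Icc_self ht⟩ : Icc (-T) T)
      (0 : ℝ) (⟨L, hL0⟩ * ⟨2 * T, by linarith⟩ + 1) 1 ⟨L, hL0⟩ K := by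
    refine ⟨fun t _ => (hKt t).lipschitzOnWith, fun y _ => ?_, fun t _ y _ => hL _, ?_⟩
    · exact (hΨ.continuous.comp (by fun_prop : Continuous fun t : ℝ => (t, y))).continuousOn
    · push_cast
      rw [add_sub_cancel_right]
      refine mul_le_mul_of_nonneg_left (max_le ?_ ?_) hL0
      · change T - t₀ ≤ 2 * T
        linarith [ht.1]
      · change t₀ - -T ≤ 2 * T
        linarith [ht.2]
  obtain ⟨α, hα, L', hL'⟩ := hpl.exists_forall_mem_closedBall_eq_hasDerivWithinAt_lipschitzOnWith
  have hα0 : EqOn (α 0) 0 (Icc (-T) T) := by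
    have hz := (hα 0 (by simp))
    refine ODE_solution_unique_of_mem_Icc (v := fun t y => Ψ (t, y)) (s := fun _ => univ)
      (fun t _ => (hKt t).lipschitzOnWith) ht (fun t ht => (hz.2 t ht).continuousWithinAt)
      (fun t ht => (hz.2 t (Ioo_subset_Icc_self ht)).hasDerivAt (Icc_mem_nhds ht.1 ht.2))
      (fun _ _ => mem_univ _) continuousOn_const (fun t _ => ?_) (fun _ _ => mem_univ _) hz.1
    simp [h0]
  refine ⟨L', L'.2, fun ε hε => ?_⟩
  have hε' : ε ∈ closedBall (0 : ℝ) (1 : NNReal) := by simpa using hε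
  obtain ⟨hi, hd⟩ := hα ε hε'
  have hcont : Continuous fun t => α ε (projIcc (-T) T hle t) := by
    have : ContinuousOn (α ε) (Icc (-T) T) := fun t ht => (hd t ht).continuousWithinAt
    exact (continuousOn_iff_continuous_domRestrict.1 this).comp continuous_projIcc
  have hcont' : Continuous fun t => Ψ (t, α ε (projIcc (-T) T hle t)) :=
    hΨ.continuous.comp (continuous_id.prodMk hcont)
  -- The Picard solution is controlled only on `[-T, T]`. Integrating the field along it, with its
  -- value frozen beyond the ends, extends it to a solution on the whole line, since `Ψ` vanishes
  -- for `t` outside.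
  set w : ℝ → ℝ := fun t => ε + ∫ s in t₀..t, Ψ (s, α ε (projIcc (-T) T hle s)) with hw
  have hw0 : w t₀ = ε := by simp [hw]
  have hwd : ∀ t, HasDerivAt w (Ψ (t, α ε (projIcc (-T) T hle t))) t := fun t =>
    (intervalIntegral.integral_hasDerivAt_right (hcont'.intervalIntegrable _ _)
      (hcont'.stronglyMeasurableAtFilter _ _) hcont'.continuousAt).const_add ε
  have heq : ∀ t ∈ Icc (-T) T, w t = α ε t := by
    intro t ht'
    have := (convex_Icc (-T) T).norm_image_sub_le_of_norm_hasDerivWithin_le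
      (f := fun t => w t - α ε t) (f' := fun _ => 0) (C := 0) (x := t₀) (y := t)
      (fun s hs => by
        have := (hwd s).hasDerivWithinAt.sub (hd s hs)
        rw [projIcc_of_mem hle hs, sub_self] at this
        exact this) (by simp) (Ioo_subset_Icc_self ht) ht'
    simp only [hw0, hi, sub_self, sub_zero, zero_mul, norm_le_zero_iff, sub_eq_zero] at this
    exact this
  refine ⟨w, hw0, fun t => ?_, fun t ht => ?_⟩
  · have := hwd t
    by_cases ht : t ∈ Icc (-T) T
    · rwa [projIcc_of_mem hle ht, ← heq t ht] at this
    · rw [hT t ht] at this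
      rwa [hT t ht]
  · rw [heq t ht]
    have := (hL' t ht).dist_le_mul ε hε' 0 (by simp)
    simpa [hα0 ht] using this

/-- The function `Ψⱼ` for which `w⁽ʲ⁾ = Ψⱼ(t, w)` if `w' = Ψ(t, w)`. -/
def iteratedField (Ψ : ℝ × ℝ → ℝ) : ℕ → ℝ × ℝ → ℝ
  | 0 => Prod.snd
  | j + 1 => fun z => fderiv ℝ (iteratedField Ψ j) z (1, Ψ z)

lemma iteratedField_succ (Ψ : ℝ × ℝ → ℝ) (j : ℕ) (z : ℝ × ℝ) :
    iteratedField Ψ (j + 1) z = fderiv ℝ (iteratedField Ψ j) z (1, Ψ z) := rfl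

lemma contDiff_iteratedField (hΨ : ContDiff ℝ ∞ Ψ) (j : ℕ) :
    ContDiff ℝ ∞ (iteratedField Ψ j) := by
  induction j with
  | zero => exact contDiff_snd
  | succ j ih =>
    exact (ih.fderiv_right (m := ∞) (by simp)).clm_apply (contDiff_const.prodMk hΨ)

lemma iteratedField_zero_right (hΨ : ContDiff ℝ ∞ Ψ) (h0 : ∀ t, Ψ (t, 0) = 0) (j : ℕ) (t : ℝ) :
    iteratedField Ψ j (t, 0) = 0 := by
  induction j generalizing t with
  | zero => rfl
  | succ j ih =>
    have h1 : HasDerivAt (fun s : ℝ => (s, (0 : ℝ))) (1, 0) t :=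
      (hasDerivAt_id t).prodMk (hasDerivAt_const t 0)
    have h2 := (((contDiff_iteratedField hΨ j).differentiable (by simp)
      (t, 0)).hasFDerivAt).comp_hasDerivAt t h1
    have h3 : iteratedField Ψ j ∘ (fun s : ℝ => (s, (0 : ℝ))) = fun _ => 0 := funext ih
    rw [h3] at h2
    rw [iteratedField_succ, h0]
    exact h2.unique (hasDerivAt_const t 0)

lemma iteratedField_succ_eq_zero (j : ℕ) {z : ℝ × ℝ} (hz : z ∉ tsupport Ψ) :
    iteratedField Ψ (j + 1) z = 0 := by
  induction j generalizing z with
  | zero =>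
    rw [iteratedField_succ, iteratedField, image_eq_zero_of_notMem_tsupport hz]
    simp [fderiv_snd]
  | succ j ih =>
    have : iteratedField Ψ (j + 1) =ᶠ[𝓝 z] fun _ => 0 :=
      eventually_of_mem ((isClosed_tsupport Ψ).isOpen_compl.mem_nhds hz) fun y hy => ih hy
    rw [iteratedField_succ, this.fderiv_eq]
    simp

lemma contDiff_of_hasDerivAt (hΨ : ContDiff ℝ ∞ Ψ) {w : ℝ → ℝ}
    (hw : ∀ t, HasDerivAt w (Ψ (t, w t)) t) : ContDiff ℝ ∞ w := by
  have hd : deriv w = fun t => Ψ (t, w t) := funext fun t => (hw t).deriv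
  have hdiff : Differentiable ℝ w := fun t => (hw t).differentiableAt
  rw [contDiff_infty]
  intro n
  induction n with
  | zero => exact contDiff_zero.2 hdiff.continuous
  | succ n ih =>
    rw [Nat.cast_succ, contDiff_succ_iff_deriv, hd]
    refine ⟨hdiff, by simp, ?_⟩
    exact (hΨ.of_le (by exact_mod_cast le_top)).comp (contDiff_id.prodMk ih)

lemma iteratedDeriv_eq_iteratedField (hΨ : ContDiff ℝ ∞ Ψ) {w : ℝ → ℝ}
    (hw : ∀ t, HasDerivAt w (Ψ (t, w t)) t) (j : ℕ) :
    iteratedDeriv j w = fun t => iteratedField Ψ j (t, w t) := by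
  induction j with
  | zero => rfl
  | succ j ih =>
    funext t
    rw [iteratedDeriv_succ, ih]
    exact (((contDiff_iteratedField hΨ j).differentiable (by simp)
      (t, w t)).hasFDerivAt.comp_hasDerivAt t ((hasDerivAt_id t).prodMk (hw t))).deriv

end ODE

/-- After truncation `w⁽ʲ⁾ = Ψⱼ(t, w)`, where `Ψⱼ` vanishes on `w = 0`; by compactness it is
uniformly small near that line. The derivative bounds hold for all real `t`, because `exists_body`
needs a global bound on `w'`. -/
theorem exists_small_solution {Φ : ℝ × ℝ → ℝ} {V : Set (ℝ × ℝ)} (hV : IsOpen V)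
    (hΦ : ContDiffOn ℝ ∞ Φ V) (h0 : ∀ t, (t, 0) ∈ V → Φ (t, 0) = 0)
    (hmem : ∀ t ∈ Icc (-1 : ℝ) 1, (t, 0) ∈ V) (k : ℕ) {η : ℝ} (hη : 0 < η) :
    ∃ w : ℝ → ℝ, ContDiff ℝ ∞ w ∧ w (-1) ≠ 0 ∧
      (∀ t ∈ Icc (-1 : ℝ) 1, |w t| ≤ η ∧ HasDerivAt w (Φ (t, w t)) t) ∧
      ∀ j, 1 ≤ j → j ≤ k → ∀ t, |iteratedDeriv j w t| ≤ η := by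
  have hKc : IsCompact (Icc (-1 : ℝ) 1 ×ˢ ({0} : Set ℝ)) := isCompact_Icc.prod isCompact_singleton
  obtain ⟨Ψ, hΨ, hΨc, hΨΦ, hΨ0⟩ := exists_compactly_supported_extension hV hΦ hKc (by
    rintro ⟨t, y⟩ ⟨ht, hy⟩
    rw [mem_singleton_iff] at hy
    subst hy
    exact hmem t ht)
  have h0' : ∀ t, Ψ (t, 0) = 0 := fun t => hΨ0 _ (h0 t)
  obtain ⟨T, hT1, hT⟩ : ∃ T : ℝ, 1 < T ∧ ∀ z ∈ tsupport Ψ, |z.1| ≤ T := by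
    obtain ⟨R, hR⟩ := hΨc.isBounded.subset_closedBall (0 : ℝ × ℝ)
    refine ⟨max R 2, by simp, fun z hz => ?_⟩
    have := mem_closedBall_zero_iff.1 (hR hz)
    exact ((norm_fst_le z).trans this).trans (le_max_left _ _)
  have hT' : ∀ t, t ∉ Icc (-T) T → ∀ y, (t, y) ∉ tsupport Ψ := fun t ht y hz =>
    ht (abs_le.1 (hT _ hz))
  obtain ⟨C, hC, hsol⟩ := exists_solution hΨ hΨc h0' (t₀ := -1) (T := T)
    ⟨by linarith, by linarith⟩ fun t ht y => image_eq_zero_of_notMem_tsupport (hT' t ht y)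
  have hnear : ∀ᶠ y in 𝓝 (0 : ℝ), ∀ t ∈ Icc (-1 : ℝ) 1, Ψ (t, y) = Φ (t, y) := by
    refine isCompact_Icc.eventually_forall_of_forall_eventually
      (P := fun y t => Ψ (t, y) = Φ (t, y)) fun t ht => ?_
    have h1 : Tendsto (fun z : ℝ × ℝ => (z.2, z.1)) (𝓝 (0, t)) (𝓝 (t, 0)) :=
      (continuous_snd.prodMk continuous_fst).tendsto' _ _ rfl
    exact h1.eventually (hΨΦ.filter_mono (nhds_le_nhdsSet (by simpa using ht)))
  have hder : ∀ j : ℕ, ∀ᶠ y in 𝓝 (0 : ℝ), ∀ t ∈ Icc (-T) T, |iteratedField Ψ j (t, y)| < η := by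
    intro j
    refine isCompact_Icc.eventually_forall_of_forall_eventually
      (P := fun y t => |iteratedField Ψ j (t, y)| < η) fun t ht => ?_
    have hcont : Continuous fun z : ℝ × ℝ => |iteratedField Ψ j (z.2, z.1)| :=
      ((contDiff_iteratedField hΨ j).continuous.comp (continuous_snd.prodMk continuous_fst)).abs
    refine hcont.continuousAt.eventually_lt continuousAt_const ?_
    simpa [iteratedField_zero_right hΨ h0'] using hη
  have hall : ∀ᶠ y in 𝓝 (0 : ℝ), |y| < η ∧ (∀ t ∈ Icc (-1 : ℝ) 1, Ψ (t, y) = Φ (t, y)) ∧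
      ∀ j ∈ Finset.range (k + 1), ∀ t ∈ Icc (-T) T, |iteratedField Ψ j (t, y)| < η := by
    refine (Metric.eventually_nhds_iff.2 ⟨η, hη, fun y hy => by simpa using hy⟩).and
      (hnear.and ?_)
    rw [Filter.eventually_all_finset]
    exact fun j _ => hder j
  obtain ⟨ρ, hρ, hball⟩ := Metric.eventually_nhds_iff.1 hall
  -- The bound `1` is required by `hsol`; the second bound makes `C * ε < ρ`, also when `C = 0`.
  set ε := min 1 (ρ / (2 * (C + 1))) with hε
  have hεpos : 0 < ε := lt_min one_pos (by positivity)
  obtain ⟨w, hw1, hwd, hwb⟩ := hsol ε (by rw [abs_of_pos hεpos]; exact min_le_left _ _)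
  have hsmall : ∀ t ∈ Icc (-T) T, dist (w t) 0 < ρ := by
    intro t ht
    rw [dist_zero_right, Real.norm_eq_abs]
    refine (hwb t ht).trans_lt ?_
    rw [abs_of_pos hεpos]
    calc C * ε ≤ C * (ρ / (2 * (C + 1))) := mul_le_mul_of_nonneg_left (min_le_right _ _) hC
      _ < ρ := by
        rw [mul_div_assoc', div_lt_iff₀ (by positivity)]
        nlinarith
  refine ⟨w, contDiff_of_hasDerivAt hΨ hwd, by rw [hw1]; exact hεpos.ne', fun t ht => ?_,
    fun j hj hjk t => ?_⟩
  · have ht' : t ∈ Icc (-T) T := ⟨by linarith [ht.1], by linarith [ht.2]⟩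
    have h := hball (hsmall t ht')
    exact ⟨h.1.le, h.2.1 t ht ▸ hwd t⟩
  · rw [iteratedDeriv_eq_iteratedField hΨ hwd]
    by_cases ht : t ∈ Icc (-T) T
    · exact ((hball (hsmall t ht)).2.2 j (Finset.mem_range.2 (by omega)) t ht).le
    · obtain ⟨i, rfl⟩ : ∃ i, j = i + 1 := ⟨j - 1, by omega⟩
      simp only [iteratedField_succ_eq_zero i (hT' t ht _), abs_zero, hη.le]

/-! ### Hypersurfaces of revolution with the profile of a deformed sphere -/

section Axial

variable {n : ℕ} {G w : ℝ → ℝ} {r : ℝ} {e x v : E n}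

/-- The map `x ↦ r x + w(x · e) e`, which moves the points parallel to the axis `e`. -/
def axialMap (r : ℝ) (w : ℝ → ℝ) (e x : E n) : E n := r • x + w ⟪x, e⟫ • e

/-- A covector that is normal to the image of the unit sphere under `axialMap`. -/
def axialConormal (r : ℝ) (w : ℝ → ℝ) (e x : E n) : E n :=
  (r + deriv w ⟪x, e⟫) • x - (⟪x, e⟫ * deriv w ⟪x, e⟫) • e

/-- The unit normal, with respect to `radialForm G`, of the image of the unit sphere under
`axialMap`, if this map is isometric up to the factor `r` on the sphere. -/
def axialNormal (G : ℝ → ℝ) (r : ℝ) (w : ℝ → ℝ) (e x : E n) : E n :=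
  (√(1 + G (‖axialMap r w e x‖ ^ 2) * ‖axialMap r w e x‖ ^ 2) / r) •
    (axialConormal r w e x - (G (‖axialMap r w e x‖ ^ 2) *
      ⟪axialMap r w e x, axialConormal r w e x⟫ /
        (1 + G (‖axialMap r w e x‖ ^ 2) * ‖axialMap r w e x‖ ^ 2)) • axialMap r w e x)

/-- The first argument is `c` times the metric dual of the covector `N`, by the same rank-one
inversion as in `gram_inv`. -/
lemma radialForm_sharp {y : E n} (h : 1 + G (‖y‖ ^ 2) * ‖y‖ ^ 2 ≠ 0) (c : ℝ) (N u : E n) :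
    radialForm G y (c • (N - (G (‖y‖ ^ 2) * ⟪y, N⟫ / (1 + G (‖y‖ ^ 2) * ‖y‖ ^ 2)) • y)) u =
      c * ⟪N, u⟫ := by
  simp only [radialForm, inner_sub_left, inner_sub_right, real_inner_smul_left,
    real_inner_smul_right, real_inner_self_eq_norm_sq]
  rw [mul_comm (G _)] at h ⊢
  field_simp
  ring

lemma radialForm_axialNormal
    (h : 1 + G (‖axialMap r w e x‖ ^ 2) * ‖axialMap r w e x‖ ^ 2 ≠ 0) (u : E n) :
    radialForm G (axialMap r w e x) (axialNormal G r w e x) u =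
      √(1 + G (‖axialMap r w e x‖ ^ 2) * ‖axialMap r w e x‖ ^ 2) / r *
        ⟪axialConormal r w e x, u⟫ :=
  radialForm_sharp h _ _ _

/-- The squared radius at the height parameter `t` of the deformed sphere. -/
def profileSq (r t a : ℝ) : ℝ := (r * t + a) ^ 2 + r ^ 2 * (1 - t ^ 2)

/-- The differential equation for the profile `a = w t`, `b = w' t` of a deformed sphere that
is isometric to the sphere of radius `r`. -/
def ProfileEq (G : ℝ → ℝ) (r t a b : ℝ) : Prop :=
  (r + b) ^ 2 + G (profileSq r t a) * ((r * t + a) * (r + b) - r ^ 2 * t) ^ 2 = r ^ 2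

section Inner

variable (hx : ‖x‖ = 1) (he : ‖e‖ = 1)
include he

lemma inner_axialMap_axis : ⟪axialMap r w e x, e⟫ = r * ⟪x, e⟫ + w ⟪x, e⟫ := by
  simp [axialMap, inner_add_left, real_inner_smul_left, he]

lemma norm_axialMap_sq' : ‖axialMap r w e x‖ ^ 2 =
    (r * ⟪x, e⟫ + w ⟪x, e⟫) ^ 2 + r ^ 2 * (‖x‖ ^ 2 - ⟪x, e⟫ ^ 2) := by
  rw [← real_inner_self_eq_norm_sq]
  simp only [axialMap, inner_add_left, inner_add_right, real_inner_smul_left,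
    real_inner_smul_right, real_inner_self_eq_norm_sq, norm_smul, mul_pow, Real.norm_eq_abs, sq_abs,
    he, real_inner_comm x e]
  ring

include hx

lemma norm_axialMap_sq : ‖axialMap r w e x‖ ^ 2 = profileSq r ⟪x, e⟫ (w ⟪x, e⟫) := by
  rw [norm_axialMap_sq' he, hx, profileSq]
  ring

lemma inner_axialMap_axialConormal : ⟪axialMap r w e x, axialConormal r w e x⟫ =
    r * ((r + deriv w ⟪x, e⟫) * (1 - ⟪x, e⟫ ^ 2) + ⟪x, e⟫ * (r * ⟪x, e⟫ + w ⟪x, e⟫)) := by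
  simp only [axialMap, axialConormal, inner_add_left, inner_sub_right, real_inner_smul_left,
    real_inner_smul_right, real_inner_self_eq_norm_sq, he, hx, real_inner_comm x e]
  ring

lemma inner_axialConormal_self : ⟪axialConormal r w e x, axialConormal r w e x⟫ =
    (r + deriv w ⟪x, e⟫) ^ 2 * (1 - ⟪x, e⟫ ^ 2) + r ^ 2 * ⟪x, e⟫ ^ 2 := by
  simp only [axialConormal, inner_sub_left, inner_sub_right, real_inner_smul_left,
    real_inner_smul_right, real_inner_self_eq_norm_sq, norm_smul, mul_pow, Real.norm_eq_abs, sq_abs,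
    he, hx, real_inner_comm x e]
  ring

/-- With `D = 1 + G(q) q`, the conormal has squared length `r² / D` in the dual metric, which
explains the factor `√D / r` in the normal. The identity `key` behind this is `1 - t²` times the
profile equation. -/
lemma radialForm_axialNormal_self (hr : 0 < r)
    (h : 0 < 1 + G (profileSq r ⟪x, e⟫ (w ⟪x, e⟫)) * profileSq r ⟪x, e⟫ (w ⟪x, e⟫))
    (hP : ProfileEq G r ⟪x, e⟫ (w ⟪x, e⟫) (deriv w ⟪x, e⟫)) :
    radialForm G (axialMap r w e x) (axialNormal G r w e x) (axialNormal G r w e x) = 1 := by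
  have hq := norm_axialMap_sq (r := r) (w := w) hx he
  rw [radialForm_axialNormal (by rw [hq]; exact h.ne'), axialNormal, real_inner_smul_right,
    inner_sub_right, real_inner_smul_right, inner_axialConormal_self hx he,
    real_inner_comm (axialMap r w e x), inner_axialMap_axialConormal hx he, hq]
  have hs := Real.sq_sqrt h.le
  rw [ProfileEq] at hP
  set c := G (profileSq r ⟪x, e⟫ (w ⟪x, e⟫)) with hc
  set S := √(1 + c * profileSq r ⟪x, e⟫ (w ⟪x, e⟫))
  set t := ⟪x, e⟫
  set a := w t
  set b := deriv w t
  set D := 1 + c * profileSq r t a with hD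
  have key : D * ((r + b) ^ 2 * (1 - t ^ 2) + r ^ 2 * t ^ 2) -
      c * (r * ((r + b) * (1 - t ^ 2) + t * (r * t + a))) ^ 2 = r ^ 2 := by
    rw [hD, profileSq]
    linear_combination (1 - t ^ 2) * hP
  set A := (r + b) ^ 2 * (1 - t ^ 2) + r ^ 2 * t ^ 2
  set M := r * ((r + b) * (1 - t ^ 2) + t * (r * t + a))
  calc S / r * (S / r * (A - c * M / D * M)) = S ^ 2 / r ^ 2 * (A - c * M ^ 2 / D) := by ring
    _ = (D * A - c * M ^ 2) / r ^ 2 := by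
      rw [hs]
      field_simp
    _ = 1 := by rw [key, div_self (by positivity)]

end Inner

/-! #### Derivatives -/

lemma hasDerivAt_inner_line (x v e : E n) :
    HasDerivAt (fun s : ℝ => ⟪x + s • v, e⟫) ⟪v, e⟫ 0 := by
  simpa [inner_add_left, real_inner_smul_left] using
    ((hasDerivAt_id (0 : ℝ)).mul_const ⟪v, e⟫).const_add ⟪x, e⟫

lemma hasDerivAt_line (x v : E n) : HasDerivAt (fun s : ℝ => x + s • v) v 0 := by
  simpa using ((hasDerivAt_id (0 : ℝ)).smul_const v).const_add x

lemma hasDerivAt_comp_line {F : Type*} [NormedAddCommGroup F] [NormedSpace ℝ F] {f : E n → F}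
    (hf : DifferentiableAt ℝ f x) : HasDerivAt (fun s : ℝ => f (x + s • v)) (fderiv ℝ f x v) 0 := by
  have h : HasFDerivAt f (fderiv ℝ f x) (x + (0 : ℝ) • v) := by simpa using hf.hasFDerivAt
  exact h.comp_hasDerivAt 0 (hasDerivAt_line x v)

lemma hasDerivAt_apply_inner_line {u : ℝ → ℝ} (hu : DifferentiableAt ℝ u ⟪x, e⟫) :
    HasDerivAt (fun s : ℝ => u ⟪x + s • v, e⟫) (deriv u ⟪x, e⟫ * ⟪v, e⟫) 0 := by
  have h : HasDerivAt u (deriv u ⟪x, e⟫) ⟪x + (0 : ℝ) • v, e⟫ := by simpa using hu.hasDerivAt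
  exact h.comp 0 (hasDerivAt_inner_line x v e)

lemma contDiff_axialMap (hw : ContDiff ℝ ∞ w) : ContDiff ℝ ∞ (axialMap r w e) := by
  have : ContDiff ℝ ∞ fun x : E n => w ⟪x, e⟫ := hw.comp (contDiff_id.inner ℝ contDiff_const)
  exact (contDiff_id.const_smul r).add (this.smul contDiff_const)

lemma contDiff_deriv (hw : ContDiff ℝ ∞ w) : ContDiff ℝ ∞ (deriv w) :=
  (contDiff_infty_iff_deriv.1 hw).2

lemma contDiff_axialConormal (hw : ContDiff ℝ ∞ w) : ContDiff ℝ ∞ (axialConormal r w e) := by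
  have h0 : ContDiff ℝ ∞ fun x : E n => ⟪x, e⟫ := contDiff_id.inner ℝ contDiff_const
  have h1 := (contDiff_deriv hw).comp h0
  exact ((contDiff_const.add h1).smul contDiff_id).sub ((h0.mul h1).smul contDiff_const)

lemma contDiffAt_axialNormal {N : ℕ∞} (hw : ContDiff ℝ ∞ w)
    (hG : ContDiffAt ℝ N G (‖axialMap r w e x‖ ^ 2))
    (h : 0 < 1 + G (‖axialMap r w e x‖ ^ 2) * ‖axialMap r w e x‖ ^ 2) :
    ContDiffAt ℝ N (axialNormal G r w e) x := by
  have hY : ContDiffAt ℝ N (axialMap r w e) x :=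
    ((contDiff_axialMap hw).of_le (by exact_mod_cast le_top)).contDiffAt
  have hN : ContDiffAt ℝ N (axialConormal r w e) x :=
    ((contDiff_axialConormal hw).of_le (by exact_mod_cast le_top)).contDiffAt
  have hq : ContDiffAt ℝ N (fun x => ‖axialMap r w e x‖ ^ 2) x := hY.norm_sq ℝ
  have hGq : ContDiffAt ℝ N (fun x => G (‖axialMap r w e x‖ ^ 2)) x :=
    ContDiffAt.comp (g := G) x hG hq
  have hD := contDiffAt_const (c := (1 : ℝ)).add (hGq.mul hq)
  exact ((hD.sqrt h.ne').div_const r).smul (hN.sub (((hGq.mul (hY.inner ℝ hN)).div hD h.ne').smul hY))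

lemma fderiv_axialMap (hw : ContDiff ℝ ∞ w) (x v : E n) :
    fderiv ℝ (axialMap r w e) x v = r • v + (deriv w ⟪x, e⟫ * ⟪v, e⟫) • e :=
  (hasDerivAt_comp_line ((contDiff_axialMap hw).differentiable (by simp) x)).unique
    (((hasDerivAt_line x v).const_smul r).add
      ((hasDerivAt_apply_inner_line (hw.differentiable (by simp) _)).smul_const e))

lemma fderiv_axialConormal (hw : ContDiff ℝ ∞ w) (x v : E n) :
    fderiv ℝ (axialConormal r w e) x v = (r + deriv w ⟪x, e⟫) • v
      + (deriv (deriv w) ⟪x, e⟫ * ⟪v, e⟫) • x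
      - (⟪v, e⟫ * deriv w ⟪x, e⟫ + ⟪x, e⟫ * (deriv (deriv w) ⟪x, e⟫ * ⟪v, e⟫)) • e := by
  have h1 := hasDerivAt_apply_inner_line (x := x) (v := v) (e := e)
    ((contDiff_deriv hw).differentiable (by simp) _)
  have h2 := ((h1.const_add r).smul (hasDerivAt_line x v)).sub
    (((hasDerivAt_inner_line x v e).mul h1).smul_const e)
  have h3 := (hasDerivAt_comp_line (v := v)
    ((contDiff_axialConormal hw).differentiable (by simp) x)).unique h2
  simpa using h3

/-- The derivative of the conormal of a hypersurface along a curve, in terms of the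
derivatives of the position `y`, the unit normal `ν` and a multiple `N` of the conormal. -/
lemma radialForm_deriv_normal {y ν N : ℝ → E n} {c : ℝ → ℝ} {y' ν' N' u : E n} {c' G' : ℝ}
    (hy : HasDerivAt y y' 0) (hν : HasDerivAt ν ν' 0) (hN : HasDerivAt N N' 0)
    (hc : HasDerivAt c c' 0) (hG : HasDerivAt G G' (‖y 0‖ ^ 2))
    (h : ∀ᶠ s in 𝓝 0, radialForm G (y s) (ν s) u = c s * ⟪N s, u⟫) (hu : ⟪N 0, u⟫ = 0) :
    radialForm G (y 0) ν' u + (G' * (⟪y 0, y'⟫ * ⟪y 0, ν 0⟫) + G (‖y 0‖ ^ 2) * ⟪y', ν 0⟫) * ⟪y 0, u⟫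
      = c 0 * ⟪N', u⟫ - ⟪y 0, ν 0⟫ * (G' * (⟪y 0, y'⟫ * ⟪y 0, u⟫) + G (‖y 0‖ ^ 2) * ⟪y', u⟫) := by
  have hu' := hasDerivAt_const (0 : ℝ) u
  have h1 : HasDerivAt (fun s => G (‖y s‖ ^ 2)) _ 0 :=
    HasDerivAt.comp (h₂ := G) 0 hG hy.norm_sq
  have h2 := (hν.inner ℝ hu').add (h1.mul ((hy.inner ℝ hν).mul (hy.inner ℝ hu')))
  -- Since `N 0` annihilates `u`, the term with `c'` drops out: the derivative of the normalizing
  -- square root never enters.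
  have h3 := hc.mul (hN.inner ℝ hu')
  have h4 := h2.unique (h3.congr_of_eventuallyEq h)
  simp only [inner_zero_right, zero_add, hu, mul_zero, Pi.mul_apply] at h4
  simp only [radialForm]
  linear_combination h4

end Axial

/-! #### Restriction to the unit sphere -/

section Sphere

variable {m : ℕ} {G w : ℝ → ℝ} {r : ℝ} {e : E (m + 1)} {p : Sph m}

/-- A tangent vector of the unit sphere as a vector of the surrounding Euclidean space. -/
def tangentVec (p : Sph m) (v : TangentSpace (𝓡 m) p) : E (m + 1) :=
  mfderiv (𝓡 m) 𝓘(ℝ, E (m + 1)) ((↑) : Sph m → E (m + 1)) p v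

lemma fact_finrank (m : ℕ) : Fact (Module.finrank ℝ (E (m + 1)) = m + 1) :=
  ⟨finrank_euclideanSpace_fin⟩

lemma contMDiff_coe_sph (m : ℕ) :
    ContMDiff (𝓡 m) 𝓘(ℝ, E (m + 1)) ∞ ((↑) : Sph m → E (m + 1)) :=
  have := fact_finrank m
  contMDiff_coe_sphere

lemma tangentVec_injective (p : Sph m) : Function.Injective (tangentVec p) :=
  have := fact_finrank m
  injective_mvfderiv_subtypeVal_sphere p

lemma range_tangentVec (p : Sph m) :
    (mfderiv (𝓡 m) 𝓘(ℝ, E (m + 1)) ((↑) : Sph m → E (m + 1)) p).range =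
      (ℝ ∙ (p : E (m + 1)))ᗮ :=
  have := fact_finrank m
  range_mvfderiv_subtypeVal p

lemma inner_tangentVec (p : Sph m) (v : TangentSpace (𝓡 m) p) :
    ⟪(p : E (m + 1)), tangentVec p v⟫ = 0 := by
  have h : tangentVec p v ∈ (mfderiv (𝓡 m) 𝓘(ℝ, E (m + 1)) ((↑) : Sph m → E (m + 1)) p).range :=
    ⟨v, rfl⟩
  rw [range_tangentVec] at h
  exact Submodule.mem_orthogonal_singleton_iff_inner_right.1 h

lemma tangentVec_zero (p : Sph m) : tangentVec p 0 = 0 := map_zero _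

lemma tangentVec_ne_zero {v : TangentSpace (𝓡 m) p} (hv : v ≠ 0) : tangentVec p v ≠ 0 :=
  fun h => hv (tangentVec_injective p (h.trans (tangentVec_zero p).symm))

lemma differential_comp_coe {F : E (m + 1) → E (m + 1)}
    (hF : DifferentiableAt ℝ F p) (v : TangentSpace (𝓡 m) p) :
    differential (fun q : Sph m => F q) p v = fderiv ℝ F p (tangentVec p v) := by
  have h1 : MDifferentiableAt 𝓘(ℝ, E (m + 1)) 𝓘(ℝ, E (m + 1)) F (p : E (m + 1)) :=
    hF.mdifferentiableAt
  have h2 : MDifferentiableAt (𝓡 m) 𝓘(ℝ, E (m + 1)) ((↑) : Sph m → E (m + 1)) p :=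
    (contMDiff_coe_sph m p).mdifferentiableAt (by simp)
  have h3 := mfderiv_comp p h1 h2
  rw [mfderiv_eq_fderiv] at h3
  exact congrArg (fun L => L v) h3

lemma norm_coe_sphere (p : Sph m) : ‖(p : E (m + 1))‖ = 1 := mem_sphere_zero_iff_norm.1 p.2

lemma differential_axialMap (hw : ContDiff ℝ ∞ w) (v : TangentSpace (𝓡 m) p) :
    differential (fun q : Sph m => axialMap r w e q) p v =
      r • tangentVec p v + (deriv w ⟪(p : E (m + 1)), e⟫ * ⟪tangentVec p v, e⟫) • e := by
  rw [differential_comp_coe ((contDiff_axialMap hw).differentiable (by simp) _),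
    fderiv_axialMap hw]

section Inner

variable {x u v : E (m + 1)} {b b' : ℝ} (he : ‖e‖ = 1)
include he

lemma inner_axialMap_tangent (hxu : ⟪x, u⟫ = 0) :
    ⟪axialMap r w e x, r • u + (b * ⟪u, e⟫) • e⟫ =
      ((r * ⟪x, e⟫ + w ⟪x, e⟫) * (r + b) - r ^ 2 * ⟪x, e⟫) * ⟪u, e⟫ := by
  simp only [axialMap, inner_add_left, inner_add_right, real_inner_smul_left,
    real_inner_smul_right, real_inner_self_eq_norm_sq, he, hxu, real_inner_comm u e]
  ring

lemma inner_tangent_tangent :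
    ⟪r • u + (b * ⟪u, e⟫) • e, r • v + (b * ⟪v, e⟫) • e⟫ =
      r ^ 2 * ⟪u, v⟫ + ((r + b) ^ 2 - r ^ 2) * (⟪u, e⟫ * ⟪v, e⟫) := by
  have hee : ⟪e, e⟫ = 1 := by rw [real_inner_self_eq_norm_sq, he, one_pow]
  rw [inner_add_left, inner_add_right, inner_add_right]
  simp only [real_inner_smul_left, real_inner_smul_right, hee, real_inner_comm v e]
  ring

lemma inner_axialConormal_tangent (hxu : ⟪x, u⟫ = 0) :
    ⟪axialConormal r w e x, r • u + (deriv w ⟪x, e⟫ * ⟪u, e⟫) • e⟫ = 0 := by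
  have hee : ⟪e, e⟫ = 1 := by rw [real_inner_self_eq_norm_sq, he, one_pow]
  rw [axialConormal, inner_sub_left, inner_add_right, inner_add_right]
  simp only [real_inner_smul_left, real_inner_smul_right, hee, hxu, real_inner_comm u e]
  ring

/-- The deviation from `r² ⟪u, v⟫` is `⟪u, e⟫ ⟪v, e⟫` times the defect of `ProfileEq`. -/
lemma radialForm_tangent (hx : ‖x‖ = 1) (hxu : ⟪x, u⟫ = 0) (hxv : ⟪x, v⟫ = 0)
    (hP : ProfileEq G r ⟪x, e⟫ (w ⟪x, e⟫) b) :
    radialForm G (axialMap r w e x) (r • u + (b * ⟪u, e⟫) • e) (r • v + (b * ⟪v, e⟫) • e) =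
      r ^ 2 * ⟪u, v⟫ := by
  rw [radialForm, inner_axialMap_tangent he hxu, inner_axialMap_tangent he hxv,
    inner_tangent_tangent he, norm_axialMap_sq hx he]
  rw [ProfileEq] at hP
  linear_combination ⟪u, e⟫ * ⟪v, e⟫ * hP

lemma inner_axialConormal_deriv (hxv : ⟪x, v⟫ = 0) {c : ℝ} :
    ⟪(r + b) • u + (c * ⟪u, e⟫) • x - (⟪u, e⟫ * b + ⟪x, e⟫ * (c * ⟪u, e⟫)) • e,
      r • v + (b * ⟪v, e⟫) • e⟫ =
      r * (r + b) * ⟪u, v⟫ - r * ⟪x, e⟫ * c * (⟪u, e⟫ * ⟪v, e⟫) := by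
  have hee : ⟪e, e⟫ = 1 := by rw [real_inner_self_eq_norm_sq, he, one_pow]
  rw [inner_sub_left, inner_add_left, inner_add_right, inner_add_right, inner_add_right]
  simp only [real_inner_smul_left, real_inner_smul_right, hee, hxv, real_inner_comm v e]
  ring

lemma inner_axialMap_axialNormal (hx : ‖x‖ = 1)
    (h : 0 < 1 + G (profileSq r ⟪x, e⟫ (w ⟪x, e⟫)) * profileSq r ⟪x, e⟫ (w ⟪x, e⟫)) :
    ⟪axialMap r w e x, axialNormal G r w e x⟫ =
      √(1 + G (profileSq r ⟪x, e⟫ (w ⟪x, e⟫)) * profileSq r ⟪x, e⟫ (w ⟪x, e⟫)) / r *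
      (r * ((r + deriv w ⟪x, e⟫) * (1 - ⟪x, e⟫ ^ 2) + ⟪x, e⟫ * (r * ⟪x, e⟫ + w ⟪x, e⟫)) /
        (1 + G (profileSq r ⟪x, e⟫ (w ⟪x, e⟫)) * profileSq r ⟪x, e⟫ (w ⟪x, e⟫))) := by
  rw [axialNormal, real_inner_smul_right, inner_sub_right, real_inner_smul_right,
    real_inner_self_eq_norm_sq, inner_axialMap_axialConormal hx he, norm_axialMap_sq hx he]
  congr 1
  set M := r * ((r + deriv w ⟪x, e⟫) * (1 - ⟪x, e⟫ ^ 2) + ⟪x, e⟫ * (r * ⟪x, e⟫ + w ⟪x, e⟫))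
  set q := profileSq r ⟪x, e⟫ (w ⟪x, e⟫)
  set c := G q
  have hD : c * M / (1 + c * q) * (1 + c * q) = c * M := div_mul_cancel₀ _ h.ne'
  rw [eq_div_iff h.ne']
  linear_combination -q * hD

end Inner

/-- The coefficient of the metric of the unit sphere in the second fundamental form of a
hypersurface of revolution. -/
def secondFormCoeff (G : ℝ → ℝ) (r t a b : ℝ) : ℝ :=
  √(1 + G (profileSq r t a) * profileSq r t a) / r * (r * (r + b) - G (profileSq r t a) * r ^ 2 *
    (r * ((r + b) * (1 - t ^ 2) + t * (r * t + a))) / (1 + G (profileSq r t a) * profileSq r t a))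

/-- The coefficient of `dt²`, where `t` is the height, in the second fundamental form of a
hypersurface of revolution. -/
def secondFormCoeffAxis (G : ℝ → ℝ) (r t a b c : ℝ) : ℝ :=
  √(1 + G (profileSq r t a) * profileSq r t a) / r * (-(r * t * c) -
    (deriv G (profileSq r t a) - G (profileSq r t a) ^ 2) *
      ((r * t + a) * (r + b) - r ^ 2 * t) ^ 2 *
    (r * ((r + b) * (1 - t ^ 2) + t * (r * t + a))) / (1 + G (profileSq r t a) * profileSq r t a))

theorem inducedMetric_axialMap {g : FormField (m + 1)} (he : ‖e‖ = 1) (hw : ContDiff ℝ ∞ w)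
    (hg : g (axialMap r w e p) = radialForm G (axialMap r w e p))
    (hP : ProfileEq G r ⟪(p : E (m + 1)), e⟫ (w ⟪(p : E (m + 1)), e⟫)
      (deriv w ⟪(p : E (m + 1)), e⟫)) (u v : TangentSpace (𝓡 m) p) :
    inducedMetric g (fun q : Sph m => axialMap r w e q) p u v =
      r ^ 2 * ⟪tangentVec p u, tangentVec p v⟫ := by
  rw [inducedMetric, differential_axialMap hw, differential_axialMap hw, hg,
    radialForm_tangent he (norm_coe_sphere p) (inner_tangentVec p u) (inner_tangentVec p v) hP]

/-- The relation between `ν` and the conormal is differentiated in the direction `u` while the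
tangent vector `T = dY(v)` is held fixed; the Christoffel term completes the left side to the
covariant derivative. -/
theorem secondFundamentalForm_axialMap {g : FormField (m + 1)} (he : ‖e‖ = 1)
    (hw : ContDiff ℝ ∞ w)
    (hg : ∀ᶠ y in 𝓝 (axialMap r w e p), g y = radialForm G y)
    (hG : ContDiffAt ℝ 1 G (profileSq r ⟪(p : E (m + 1)), e⟫ (w ⟪(p : E (m + 1)), e⟫)))
    (h : 0 < 1 + G (profileSq r ⟪(p : E (m + 1)), e⟫ (w ⟪(p : E (m + 1)), e⟫)) *
      profileSq r ⟪(p : E (m + 1)), e⟫ (w ⟪(p : E (m + 1)), e⟫))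
    (hP : ProfileEq G r ⟪(p : E (m + 1)), e⟫ (w ⟪(p : E (m + 1)), e⟫)
      (deriv w ⟪(p : E (m + 1)), e⟫)) (u v : TangentSpace (𝓡 m) p) :
    secondFundamentalForm g (fun q : Sph m => axialMap r w e q)
      (fun q : Sph m => axialNormal G r w e q) p u v =
      secondFormCoeff G r ⟪(p : E (m + 1)), e⟫ (w ⟪(p : E (m + 1)), e⟫)
        (deriv w ⟪(p : E (m + 1)), e⟫) * ⟪tangentVec p u, tangentVec p v⟫
      + secondFormCoeffAxis G r ⟪(p : E (m + 1)), e⟫ (w ⟪(p : E (m + 1)), e⟫)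
        (deriv w ⟪(p : E (m + 1)), e⟫) (deriv (deriv w) ⟪(p : E (m + 1)), e⟫) *
        (⟪tangentVec p u, e⟫ * ⟪tangentVec p v, e⟫) := by
  have hx := norm_coe_sphere p
  have hxu := inner_tangentVec p u
  have hxv := inner_tangentVec p v
  have hq := norm_axialMap_sq (r := r) (w := w) hx he
  have hG' : ContDiffAt ℝ 1 G (‖axialMap r w e p‖ ^ 2) := by rwa [hq]
  have hd : HasDerivAt G (deriv G (‖axialMap r w e p‖ ^ 2)) (‖axialMap r w e p‖ ^ 2) :=
    (hG'.differentiableAt (by simp)).hasDerivAt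
  have h' : 0 < 1 + G (‖axialMap r w e p‖ ^ 2) * ‖axialMap r w e p‖ ^ 2 := by rwa [hq]
  have hνd : DifferentiableAt ℝ (axialNormal G r w e) (p : E (m + 1)) :=
    (contDiffAt_axialNormal (N := 1) hw hG' h').differentiableAt (by simp)
  have hYd : DifferentiableAt ℝ (axialMap r w e) (p : E (m + 1)) :=
    (contDiff_axialMap hw).differentiable (by simp) _
  have hNd : DifferentiableAt ℝ (axialConormal r w e) (p : E (m + 1)) :=
    (contDiff_axialConormal hw).differentiable (by simp) _
  have hqd : DifferentiableAt ℝ (fun x => 1 + G (‖axialMap r w e x‖ ^ 2) * ‖axialMap r w e x‖ ^ 2)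
      (p : E (m + 1)) := by
    have h1 := hYd.norm_sq ℝ
    have h2 : DifferentiableAt ℝ (fun x => G (‖axialMap r w e x‖ ^ 2)) (p : E (m + 1)) :=
      DifferentiableAt.comp (g := G) _ hd.differentiableAt h1
    exact (h2.mul h1).const_add 1
  set u' := tangentVec p u
  set v' := tangentVec p v
  set x : E (m + 1) := Subtype.val p
  rw [secondFundamentalForm, differential_axialMap hw, differential_axialMap hw,
    differential_comp_coe hνd, hg.self_of_nhds]
  set T := r • v' + (deriv w ⟪x, e⟫ * ⟪v', e⟫) • e with hT
  have hΓ := radialForm_christoffelVec (x := axialMap r w e x) hd hg h'.ne' T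
    (r • u' + (deriv w ⟪x, e⟫ * ⟪u', e⟫) • e) (axialNormal G r w e x)
  have hx0 : x + (0 : ℝ) • u' = x := by simp
  have hpos : ∀ᶠ s : ℝ in 𝓝 0, 0 < 1 + G (‖axialMap r w e (x + s • u')‖ ^ 2) *
      ‖axialMap r w e (x + s • u')‖ ^ 2 := by
    have hc := (hasDerivAt_comp_line (v := u') hqd).continuousAt
    exact continuousAt_const.eventually_lt hc (by simpa using h')
  have hmain := radialForm_deriv_normal (G := G) (u := T)
    (G' := deriv G (‖axialMap r w e x‖ ^ 2))
    (c := fun s => √(1 + G (‖axialMap r w e (x + s • u')‖ ^ 2) *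
      ‖axialMap r w e (x + s • u')‖ ^ 2) / r)
    (hasDerivAt_comp_line (v := u') hYd) (hasDerivAt_comp_line (v := u') hνd)
    (hasDerivAt_comp_line (v := u') hNd)
    (((hasDerivAt_comp_line (v := u') hqd).sqrt (by simpa using h'.ne')).div_const r)
    (by simpa only [hx0] using hd)
    (hpos.mono fun s hs => radialForm_axialNormal hs.ne' T)
    (by simpa using inner_axialConormal_tangent he hxv)
  simp only [hx0, fderiv_axialMap hw, fderiv_axialConormal hw] at hmain
  have hadd : ∀ a b : E (m + 1), radialForm G (axialMap r w e x) (a + b) T =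
      radialForm G (axialMap r w e x) a T + radialForm G (axialMap r w e x) b T := by
    intro a b
    simp only [radialForm, inner_add_left, inner_add_right]
    ring
  rw [hadd, hΓ, hmain, inner_axialConormal_deriv he hxv, inner_axialMap_axialNormal he hx h,
    inner_axialMap_tangent he hxu, inner_axialMap_tangent he hxv, inner_tangent_tangent he, hq,
    secondFormCoeff, secondFormCoeffAxis]
  rw [ProfileEq] at hP
  set t := ⟪x, e⟫
  set a := w t
  set b := deriv w t
  set q := profileSq r t a
  set S := √(1 + G q * q)
  set M := r * ((r + b) * (1 - t ^ 2) + t * (r * t + a))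
  -- The profile equation replaces `(r + b)² - r²` by `-G` times a square; this is the source of
  -- `G²` in `secondFormCoeffAxis`.
  linear_combination -(S / r * (M / (1 + G q * q)) * G q * (⟪u', e⟫ * ⟪v', e⟫)) * hP

end Sphere

/-! #### The body bounded by a hypersurface of revolution -/

section Body

lemma eventually_lt_of_hasDerivAt_pos {F : ℝ → ℝ} {d : ℝ} (hF : HasDerivAt F d 0) (hd : 0 < d) :
    ∀ᶠ s in 𝓝[>] (0 : ℝ), F 0 < F s ∧ F (-s) < F 0 := by
  have h := (hasDerivAt_iff_tendsto_slope.1 hF).eventually (lt_mem_nhds hd)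
  have h1 : Tendsto (fun s : ℝ => s) (𝓝[>] 0) (𝓝[≠] 0) :=
    tendsto_id.mono_left (nhdsWithin_mono _ fun s hs => (mem_Ioi.1 hs).ne')
  have h2 : Tendsto (fun s : ℝ => -s) (𝓝[>] 0) (𝓝[≠] 0) := by
    refine tendsto_nhdsWithin_iff.2 ⟨?_, ?_⟩
    · exact (continuous_neg.tendsto' 0 0 neg_zero).mono_left nhdsWithin_le_nhds
    · filter_upwards [self_mem_nhdsWithin] with s hs
      exact neg_ne_zero.2 (mem_Ioi.1 hs).ne'
  filter_upwards [h1.eventually h, h2.eventually h, self_mem_nhdsWithin] with s hs1 hs2 hs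
  rw [slope_def_field, sub_zero] at hs1 hs2
  have hs : 0 < s := hs
  constructor
  · exact sub_pos.1 ((div_pos_iff_of_pos_right hs).1 hs1)
  · rw [div_neg, neg_pos, div_lt_iff₀ hs, zero_mul] at hs2
    exact sub_neg.1 hs2

variable {w : ℝ → ℝ} {r : ℝ}

lemma exists_profile_inverse (hr : 0 < r) (hw : ContDiff ℝ ∞ w)
    (hb : ∀ t, |deriv w t| ≤ r / 2) :
    ∃ T : ℝ → ℝ, Continuous T ∧ (∀ t, T (r * t + w t) = t) ∧ (∀ s, r * T s + w (T s) = s) ∧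
      ∀ t, HasDerivAt T (r + deriv w t)⁻¹ (r * t + w t) := by
  have hd : ∀ t, HasDerivAt (fun t => r * t + w t) (r + deriv w t) t := fun t =>
    (((hasDerivAt_id t).const_mul r).add (hw.differentiable (by simp) t).hasDerivAt).congr_deriv
      (by rw [mul_one])
  have hcont : Continuous fun t => r * t + w t := by
    have := hw.continuous
    fun_prop
  have hlow : ∀ t, r / 2 ≤ r + deriv w t := fun t => by linarith [(abs_le.1 (hb t)).1]
  have hmono : StrictMono fun t => r * t + w t :=
    strictMono_of_deriv_pos fun t => by
      rw [(hd t).deriv]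
      linarith [hlow t]
  -- As `r t + w t` grows at least as fast as a line of slope `r / 2`, it is onto.
  have hmono' : Monotone fun t => r * t + w t - r / 2 * t := by
    have hd' : ∀ t, HasDerivAt (fun t => r * t + w t - r / 2 * t) (r + deriv w t - r / 2) t :=
      fun t => ((hd t).sub ((hasDerivAt_id t).const_mul (r / 2))).congr_deriv (by rw [mul_one])
    refine monotone_of_deriv_nonneg (fun t => (hd' t).differentiableAt) fun t => ?_
    rw [(hd' t).deriv]
    linarith [hlow t]
  have hsurj : Function.Surjective fun t => r * t + w t := by
    refine hcont.surjective ?_ ?_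
    · refine tendsto_atTop_mono' _ ?_
        (tendsto_atTop_add_const_left _ (w 0) (tendsto_id.const_mul_atTop (half_pos hr)))
      filter_upwards [eventually_ge_atTop 0] with t ht
      have := hmono' ht
      simp only [mul_zero, zero_add, sub_zero, id] at this ⊢
      linarith
    · refine tendsto_atBot_mono' _ ?_
        (tendsto_atBot_add_const_left _ (w 0) (tendsto_id.const_mul_atBot (half_pos hr)))
      filter_upwards [eventually_le_atBot 0] with t ht
      have := hmono' ht
      simp only [mul_zero, zero_add, sub_zero, id] at this ⊢
      linarith
  set h := (hmono.orderIsoOfSurjective _ hsurj).toHomeomorph with hh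
  have h1 : ∀ t, h.symm (r * t + w t) = t := fun t => h.symm_apply_apply t
  have h2 : ∀ s, r * h.symm s + w (h.symm s) = s := fun s => h.apply_symm_apply s
  refine ⟨h.symm, h.symm.continuous, h1, h2, fun t => ?_⟩
  refine HasDerivAt.of_local_left_inverse (f := fun t => r * t + w t)
    h.symm.continuous.continuousAt ?_ ?_ (Eventually.of_forall h2)
  · rw [h1]
    exact hd t
  · linarith [hlow t]

/-- `axialMap` is a homeomorphism of the whole space: it scales the component orthogonal to `e` by
`r` and maps heights by an increasing bijection. The body is the image of the unit ball, `Q` is the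
squared norm of the preimage, and on the surface the gradient of `Q` is a positive multiple of the
conormal. -/
theorem exists_body {m : ℕ} {e : E (m + 1)} (he : ‖e‖ = 1) (hr : 0 < r) (hw : ContDiff ℝ ∞ w)
    (hb : ∀ t, |deriv w t| ≤ r / 2) :
    Function.Injective (axialMap r w e) ∧
    ∃ Ω : Set (E (m + 1)), IsOpen Ω ∧ Bornology.IsBounded Ω ∧
      frontier Ω = range (fun p : Sph m => axialMap r w e p) ∧
      ∀ (p : Sph m) (ν : E (m + 1)), 0 < ⟪axialConormal r w e p, ν⟫ →
        ∀ᶠ s in 𝓝[>] (0 : ℝ), axialMap r w e p + s • ν ∉ closure Ω ∧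
          axialMap r w e p - s • ν ∈ Ω := by
  obtain ⟨T, hT, hT1, hT2, hTd⟩ := exists_profile_inverse hr hw hb
  have hee : ⟪e, e⟫ = 1 := by rw [real_inner_self_eq_norm_sq, he, one_pow]
  have hcont : Continuous (axialMap r w e) := (contDiff_axialMap hw).continuous
  let h : E (m + 1) ≃ₜ E (m + 1) :=
    { toFun := axialMap r w e
      invFun := fun z => r⁻¹ • (z - ⟪z, e⟫ • e) + T ⟪z, e⟫ • e
      left_inv := fun x => by
        simp only [inner_axialMap_axis he, hT1]
        rw [axialMap, show r • x + w ⟪x, e⟫ • e - (r * ⟪x, e⟫ + w ⟪x, e⟫) • e =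
          r • (x - ⟪x, e⟫ • e) by module, smul_smul, inv_mul_cancel₀ hr.ne']
        module
      right_inv := fun z => by
        have h1 : ⟪r⁻¹ • (z - ⟪z, e⟫ • e) + T ⟪z, e⟫ • e, e⟫ = T ⟪z, e⟫ := by
          rw [inner_add_left, real_inner_smul_left, inner_sub_left, real_inner_smul_left,
            real_inner_smul_left, hee]
          ring
        simp only [axialMap, h1]
        rw [smul_add, smul_smul, mul_inv_cancel₀ hr.ne', one_smul, smul_smul, add_assoc, ← add_smul,
          hT2]
        module
      continuous_toFun := hcont
      continuous_invFun := by fun_prop }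
  have hh : ∀ x, h x = axialMap r w e x := fun _ => rfl
  set Q : E (m + 1) → ℝ := fun z => (‖z‖ ^ 2 - ⟪z, e⟫ ^ 2) / r ^ 2 + T ⟪z, e⟫ ^ 2 with hQ
  have hQh : ∀ x, Q (h x) = ‖x‖ ^ 2 := by
    intro x
    simp only [hQ, hh, inner_axialMap_axis he, hT1, norm_axialMap_sq' he]
    field_simp
    ring
  have hball : ∀ z, z ∈ h '' ball 0 1 ↔ Q z < 1 := by
    intro z
    obtain ⟨x, rfl⟩ := h.surjective z
    rw [h.injective.mem_set_image, hQh, mem_ball_zero_iff, sq_lt_one_iff₀ (norm_nonneg _)]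
  have hcball : ∀ z, z ∈ closure (h '' ball 0 1) ↔ Q z ≤ 1 := by
    intro z
    obtain ⟨x, rfl⟩ := h.surjective z
    rw [← h.image_closure, closure_ball _ one_ne_zero, h.injective.mem_set_image, hQh,
      mem_closedBall_zero_iff, sq_le_one_iff₀ (norm_nonneg _)]
  refine ⟨h.injective, h '' ball 0 1, h.isOpenMap _ isOpen_ball, ?_, ?_, fun p ν hν => ?_⟩
  · exact ((isCompact_closedBall (0 : E (m + 1)) 1).image h.continuous).isBounded.subset
      (image_mono ball_subset_closedBall)
  · rw [← h.image_frontier, frontier_ball _ one_ne_zero]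
    ext z
    simp [hh]
  · have hlow : 0 < r + deriv w ⟪(p : E (m + 1)), e⟫ := by
      linarith [(abs_le.1 (hb ⟪(p : E (m + 1)), e⟫)).1]
    have hder : HasDerivAt (fun s : ℝ => Q (axialMap r w e p + s • ν))
        (2 / (r * (r + deriv w ⟪(p : E (m + 1)), e⟫)) * ⟪axialConormal r w e p, ν⟫) 0 := by
      have h1 := hasDerivAt_inner_line (axialMap r w e p) ν e
      have h2 := (hasDerivAt_line (axialMap r w e p) ν).norm_sq
      have h3 : HasDerivAt T (r + deriv w ⟪(p : E (m + 1)), e⟫)⁻¹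
          ⟪axialMap r w e p + (0 : ℝ) • ν, e⟫ := by
        rw [zero_smul, add_zero, inner_axialMap_axis he]
        exact hTd _
      have h4 : HasDerivAt (fun s : ℝ => T ⟪axialMap r w e p + s • ν, e⟫) _ 0 := h3.comp 0 h1
      have h5 := ((h2.sub (h1.pow 2)).div_const (r ^ 2)).add (h4.pow 2)
      refine h5.congr_deriv ?_
      simp only [zero_smul, add_zero, inner_axialMap_axis he, hT1]
      simp only [axialMap, axialConormal, inner_add_left, inner_sub_left, real_inner_smul_left,
        real_inner_comm ν e]
      field_simp
      ring
    have hQ0 : Q (axialMap r w e p + (0 : ℝ) • ν) = 1 := by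
      rw [zero_smul, add_zero, ← hh, hQh, norm_coe_sphere, one_pow]
    have hev := eventually_lt_of_hasDerivAt_pos hder (by positivity)
    filter_upwards [hev] with s hs
    rw [hQ0, neg_smul, ← sub_eq_add_neg] at hs
    rw [hball, hcball, not_le]
    exact hs

end Body

/-! #### Closeness in `C^k` -/

section Close

/-- The radial extension of the difference is `w(h(x)) e` with `h(x) = ⟪x, e⟫ / ‖x‖`. The
derivatives of `h` on the unit sphere do not depend on `w`, and the chain rule estimate for higher
derivatives applies. -/
theorem exists_ckClose {m : ℕ} {e : E (m + 1)} (he : ‖e‖ = 1) (r : ℝ) (k : ℕ) {δ : ℝ}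
    (hδ : 0 < δ) :
    ∃ η > 0, ∀ w : ℝ → ℝ, ContDiff ℝ ∞ w →
      (∀ j ≤ k, ∀ t ∈ Icc (-1 : ℝ) 1, |iteratedDeriv j w t| ≤ η) →
      CkClose k δ (fun p : Sph m => axialMap r w e p) (slice r) := by
  set h : E (m + 1) → ℝ := fun x => ⟪x, e⟫ / ‖x‖ with hh
  have hopen : IsOpen ({0}ᶜ : Set (E (m + 1))) := isOpen_compl_singleton
  have hsm : ContDiffOn ℝ ∞ h {0}ᶜ := fun x hx =>
    ((contDiffAt_id.inner ℝ contDiffAt_const).div (contDiffAt_norm ℝ hx)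
      (norm_ne_zero_iff.2 hx)).contDiffWithinAt
  have hsub : sphere (0 : E (m + 1)) 1 ⊆ {0}ᶜ := fun x hx => by
    rw [mem_sphere_zero_iff_norm] at hx
    rintro rfl
    simp at hx
  have hbd : ∀ i : ℕ, ∃ D : ℝ, ∀ x ∈ sphere (0 : E (m + 1)) 1,
      ‖iteratedFDerivWithin ℝ i h {0}ᶜ x‖ ≤ D := fun i =>
    (isCompact_sphere (0 : E (m + 1)) 1).exists_bound_of_continuousOn
      ((hsm.continuousOn_iteratedFDerivWithin (by exact_mod_cast le_top)
        hopen.uniqueDiffOn).mono hsub)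
  choose D hD using hbd
  -- `B ≥ 1` gives `D i ≤ B ≤ B ^ i` for `i ≥ 1`, the form needed in the chain rule estimate.
  set B : ℝ := 1 + ∑ i ∈ Finset.range (k + 1), |D i| with hB
  have hB1 : 1 ≤ B := le_add_of_nonneg_right (Finset.sum_nonneg fun _ _ => abs_nonneg _)
  have hDB : ∀ i ≤ k, D i ≤ B := fun i hi => by
    have := Finset.single_le_sum (f := fun i => |D i|) (fun _ _ => abs_nonneg _)
      (Finset.mem_range.2 (Nat.lt_succ_of_le hi))
    linarith [le_abs_self (D i)]
  have hpos : 0 < (k.factorial : ℝ) * B ^ k := by positivity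
  refine ⟨δ / (2 * (k.factorial * B ^ k)), by positivity, fun w hw hwb p j hj => ?_⟩
  set η := δ / (2 * (k.factorial * B ^ k)) with hη
  have hp : ‖(p : E (m + 1))‖ = 1 := norm_coe_sphere p
  have hp0 : (p : E (m + 1)) ∈ ({0}ᶜ : Set (E (m + 1))) := hsub p.2
  set L : ℝ →L[ℝ] E (m + 1) := ContinuousLinearMap.toSpanSingleton ℝ e with hL
  have heq : radialExt (fun q : Sph m => axialMap r w e q - slice r q) =ᶠ[𝓝 (p : E (m + 1))]
      (L ∘ w) ∘ h := by
    filter_upwards [hopen.mem_nhds hp0] with x hx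
    have hx' : x ≠ 0 := hx
    simp only [radialExt, dif_pos hx', axialMap, slice, add_sub_cancel_left, real_inner_smul_left,
      Function.comp, hL, hh, ContinuousLinearMap.toSpanSingleton_apply, div_eq_inv_mul]
  rw [(heq.iteratedFDeriv ℝ j).eq_of_nhds, ← iteratedFDerivWithin_of_isOpen j hopen hp0]
  have hmem : h p ∈ Icc (-1 : ℝ) 1 := by
    have h1 := abs_real_inner_le_norm (p : E (m + 1)) e
    rw [hp, he, mul_one] at h1
    simp only [hh, hp, div_one]
    exact abs_le.1 h1
  have hbound := norm_iteratedFDerivWithin_comp_le (g := L ∘ w) (f := h) (n := j) (s := {0}ᶜ)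
    (t := univ) (x := (p : E (m + 1))) (N := ∞) (L.contDiff.comp hw).contDiffOn hsm
    (by exact_mod_cast le_top) uniqueDiffOn_univ hopen.uniqueDiffOn (mapsTo_univ _ _) hp0
    (C := η) (D := B) (fun i hi => by
      rw [iteratedFDerivWithin_univ]
      refine (L.norm_iteratedFDeriv_comp_left hw.contDiffAt
        (by exact_mod_cast le_top)).trans ?_
      rw [norm_iteratedFDeriv_eq_norm_iteratedDeriv, hL,
        ContinuousLinearMap.norm_toSpanSingleton, he, one_mul]
      exact hwb i (hi.trans hj) _ hmem)
    (fun i hi1 hi => ((hD i p p.2).trans (hDB i (hi.trans hj))).trans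
      (le_self_pow₀ hB1 (by omega)))
  refine hbound.trans_lt ?_
  have h1 : (j.factorial : ℝ) * η * B ^ j ≤ k.factorial * η * B ^ k := by
    have hη0 : 0 ≤ η := by positivity
    gcongr
  refine h1.trans_lt ?_
  have : (k.factorial : ℝ) * η * B ^ k = δ / 2 := by
    rw [hη]
    field_simp
  linarith

end Close

/-! ### Warped product metrics -/

section Warped

variable {f : ℝ → ℝ} {I : Set ℝ} {r : ℝ} {n : ℕ}

/-- The function `G` for which the warped product metric is `dx² + G(|x|²) (x · dx)²`. -/
def warpCoeff (f : ℝ → ℝ) : ℝ → ℝ := fun q => (1 / f √q ^ 2 - 1) / q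

/-- The squares of the positive radii in `I`. -/
def squaredRadii (I : Set ℝ) : Set ℝ := {q | 0 < q ∧ √q ∈ I}

lemma warpedMetric_eq_radialForm {x : E n} (hx : x ≠ 0) :
    warpedMetric f x = radialForm (warpCoeff f) x := by
  have hx' : ‖x‖ ≠ 0 := norm_ne_zero_iff.2 hx
  funext v w
  rw [warpedMetric, radialForm, warpCoeff, Real.sqrt_sq (norm_nonneg x)]
  field_simp
  ring

lemma one_add_warpCoeff_mul {q : ℝ} (hq : 0 < q) : 1 + warpCoeff f q * q = 1 / f √q ^ 2 := by
  rw [warpCoeff, div_mul_cancel₀ _ hq.ne']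
  ring

lemma isOpen_squaredRadii (hI : IsOpen I) : IsOpen (squaredRadii I) :=
  isOpen_Ioi.inter (hI.preimage Real.continuous_sqrt)

lemma sq_mem_squaredRadii (hr : r ∈ I) (hr0 : 0 < r) : r ^ 2 ∈ squaredRadii I :=
  ⟨by positivity, by rwa [Real.sqrt_sq hr0.le]⟩

variable (hf : IsWarpingFunction n I f)
include hf

lemma IsWarpingFunction.pos_sqrt {q : ℝ} (hq : q ∈ squaredRadii I) : 0 < f √q :=
  hf.pos _ hq.2 (Real.sqrt_pos.2 hq.1)

lemma IsWarpingFunction.one_add_warpCoeff_mul_pos {q : ℝ} (hq : q ∈ squaredRadii I) :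
    0 < 1 + warpCoeff f q * q := by
  have := hf.pos_sqrt hq
  rw [one_add_warpCoeff_mul hq.1]
  positivity

lemma IsWarpingFunction.contDiffOn_warpCoeff : ContDiffOn ℝ ∞ (warpCoeff f) (squaredRadii I) := by
  have h1 : ContDiffOn ℝ ∞ (fun q => √q) (squaredRadii I) :=
    contDiffOn_id.sqrt fun q hq => hq.1.ne'
  have h2 : ContDiffOn ℝ ∞ (fun q => f √q) (squaredRadii I) :=
    hf.smooth.comp h1 fun q hq => ⟨hq.2, Real.sqrt_pos.2 hq.1⟩
  exact ((contDiffOn_const.div (h2.pow 2) fun q hq => (pow_pos (hf.pos_sqrt hq) 2).ne').sub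
    contDiffOn_const).div contDiffOn_id fun q hq => hq.1.ne'

lemma IsWarpingFunction.contDiffAt_warpCoeff {q : ℝ} (hq : q ∈ squaredRadii I) :
    ContDiffAt ℝ ∞ (warpCoeff f) q :=
  hf.contDiffOn_warpCoeff.contDiffAt ((isOpen_squaredRadii hf.isOpen).mem_nhds hq)

lemma IsWarpingFunction.hasDerivAt (hr : r ∈ I) (hr0 : 0 < r) : HasDerivAt f (deriv f r) r :=
  ((hf.smooth.contDiffAt ((hf.isOpen.inter isOpen_Ioi).mem_nhds ⟨hr, hr0⟩)).differentiableAt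
    (by simp)).hasDerivAt

/-- For `n ≥ 3`, `(1 - f²)/ρ²` is the sectional curvature of planes tangent to the slices. The
quantity in the theorem measures whether it is stationary at `r`. -/
lemma IsWarpingFunction.hasDerivAt_curvature (hr : r ∈ I) (hr0 : 0 < r) :
    HasDerivAt (fun ρ => (f ρ ^ 2 - 1) / ρ ^ 2)
      (2 / r * (f r * deriv f r / r + (1 - f r ^ 2) / r ^ 2)) r := by
  have h := (((hf.hasDerivAt hr hr0).pow 2).sub_const 1).div ((hasDerivAt_id r).pow 2)
    (by simpa using hr0.ne')
  refine h.congr_deriv ?_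
  simp only [Pi.pow_apply, id]
  field_simp
  ring

end Warped

/-! ### The differential equation for the profile -/

section Profile

variable {G : ℝ → ℝ} {r t a b : ℝ}

/-- The solution `b` of `ProfileEq` that vanishes for `a = 0`. -/
def profileField (G : ℝ → ℝ) (r : ℝ) : ℝ × ℝ → ℝ := fun z =>
  (G (profileSq r z.1 z.2) * (r * z.1 + z.2) * r ^ 2 * z.1
    + r * √(1 + G (profileSq r z.1 z.2) * (2 * r * z.1 * z.2 + z.2 ^ 2)))
    / (1 + G (profileSq r z.1 z.2) * (r * z.1 + z.2) ^ 2) - r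

/-- The domain where `profileField` is defined and smooth if `G` is smooth in `O`. -/
def profileDomain (G : ℝ → ℝ) (O : Set ℝ) (r : ℝ) : Set (ℝ × ℝ) :=
  {z | profileSq r z.1 z.2 ∈ O} ∩
    {z | 0 < 1 + G (profileSq r z.1 z.2) * (r * z.1 + z.2) ^ 2 ∧
      0 < 1 + G (profileSq r z.1 z.2) * (2 * r * z.1 * z.2 + z.2 ^ 2)}

lemma profileSq_zero (r t : ℝ) : profileSq r t 0 = r ^ 2 := by
  rw [profileSq]
  ring

lemma contDiff_profileSq (r : ℝ) : ContDiff ℝ ∞ fun z : ℝ × ℝ => profileSq r z.1 z.2 := by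
  unfold profileSq
  fun_prop

lemma profileEq_zero (G : ℝ → ℝ) (r t : ℝ) : ProfileEq G r t 0 0 := by
  rw [ProfileEq]
  ring

/-- `P = r + b` solves a quadratic equation with leading coefficient `D`; a quarter of its
discriminant is `r² (1 + c (2 r t a + a²))`. -/
lemma profileEq_profileField {O : Set ℝ} (h : (t, a) ∈ profileDomain G O r) :
    ProfileEq G r t a (profileField G r (t, a)) := by
  obtain ⟨-, h1, h2⟩ := h
  simp only at h1 h2
  have hs := Real.sq_sqrt h2.le
  simp only [ProfileEq, profileField]
  set c := G (profileSq r t a)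
  set S := √(1 + c * (2 * r * t * a + a ^ 2))
  set D := 1 + c * (r * t + a) ^ 2 with hD
  set P := (c * (r * t + a) * r ^ 2 * t + r * S) / D with hP
  have hPD : P * D = c * (r * t + a) * r ^ 2 * t + r * S := div_mul_cancel₀ _ h1.ne'
  have key : D * ((r + (P - r)) ^ 2 + c * ((r * t + a) * (r + (P - r)) - r ^ 2 * t) ^ 2 - r ^ 2)
      = 0 := by
    rw [show D * ((r + (P - r)) ^ 2 + c * ((r * t + a) * (r + (P - r)) - r ^ 2 * t) ^ 2 - r ^ 2) =
      (P * D) ^ 2 - 2 * c * (r * t + a) * r ^ 2 * t * (P * D) + D * (c * r ^ 4 * t ^ 2 - r ^ 2) by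
        rw [hD]; ring, hPD, hD]
    linear_combination r ^ 2 * hs
  exact sub_eq_zero.1 ((mul_eq_zero.1 key).resolve_left h1.ne')

variable {O : Set ℝ} (hO : IsOpen O) (hG : ContDiffOn ℝ ∞ G O)
include hG

lemma contDiffOn_comp_profileSq :
    ContDiffOn ℝ ∞ (fun z : ℝ × ℝ => G (profileSq r z.1 z.2)) {z | profileSq r z.1 z.2 ∈ O} :=
  hG.comp (contDiff_profileSq r).contDiffOn fun _ hz => hz

lemma contDiffOn_profileField :
    ContDiffOn ℝ ∞ (profileField G r) (profileDomain G O r) := by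
  have h := (contDiffOn_comp_profileSq (r := r) hG).mono
    (inter_subset_left : profileDomain G O r ⊆ _)
  have h1 : ContDiffOn ℝ ∞ (fun z : ℝ × ℝ => r * z.1 + z.2) (profileDomain G O r) := by fun_prop
  have h2 : ContDiffOn ℝ ∞ (fun z : ℝ × ℝ => 2 * r * z.1 * z.2 + z.2 ^ 2) (profileDomain G O r) := by
    fun_prop
  exact ((((h.mul h1).mul contDiffOn_const).mul contDiffOn_fst).add
    (contDiffOn_const.mul ((contDiffOn_const.add (h.mul h2)).sqrt fun z hz => hz.2.2.ne'))).div
    (contDiffOn_const.add (h.mul (h1.pow 2))) (fun z hz => hz.2.1.ne') |>.sub contDiffOn_const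

include hO

lemma isOpen_profileDomain : IsOpen (profileDomain G O r) := by
  have h := (contDiffOn_comp_profileSq (r := r) hG).continuousOn
  have h1 : ContinuousOn (fun z : ℝ × ℝ =>
      ((1 + G (profileSq r z.1 z.2) * (r * z.1 + z.2) ^ 2,
        1 + G (profileSq r z.1 z.2) * (2 * r * z.1 * z.2 + z.2 ^ 2)) : ℝ × ℝ))
      {z | profileSq r z.1 z.2 ∈ O} :=
    (continuousOn_const.add (h.mul (Continuous.continuousOn (by fun_prop)))).prodMk
      (continuousOn_const.add (h.mul (Continuous.continuousOn (by fun_prop))))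
  exact h1.isOpen_inter_preimage (hO.preimage (contDiff_profileSq r).continuous)
    (isOpen_Ioi.prod isOpen_Ioi)

end Profile

/-! ### Small profiles: solvability, convexity and the Gauss equation at the poles -/

section Small

variable {G : ℝ → ℝ} {r : ℝ} {O : Set ℝ}

lemma mem_profileDomain_zero (hr : r ^ 2 ∈ O) (h : 0 < 1 + G (r ^ 2) * r ^ 2) {t : ℝ}
    (ht : t ∈ Icc (-1 : ℝ) 1) : (t, 0) ∈ profileDomain G O r := by
  have ht2 : t ^ 2 ≤ 1 := by
    rw [sq_le_one_iff_abs_le_one]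
    exact abs_le.2 ht
  refine ⟨by simpa [profileSq_zero] using hr, ?_, ?_⟩
  · simp only [profileSq_zero, add_zero]
    rcases eq_or_ne t 0 with rfl | h0
    · simp
    -- `1 + G r² t²` is the convex combination of `1 + G r²` and `1` with weights `t²` and `1 - t²`.
    · nlinarith [mul_pos (pow_pos (abs_pos.2 h0) 2) h, sq_abs t]
  · simp

lemma profileField_zero {t : ℝ} (h : (t, 0) ∈ profileDomain G O r) :
    profileField G r (t, 0) = 0 := by
  have h1 := h.2.1
  simp only [profileSq_zero, add_zero] at h1
  simp only [profileField, profileSq_zero, add_zero, mul_zero]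
  norm_num
  rw [sub_eq_zero, div_eq_iff h1.ne']
  ring

lemma secondFormCoeff_zero (hr : 0 < r) (h : 0 < 1 + G (r ^ 2) * r ^ 2) (t : ℝ) :
    0 < secondFormCoeff G r t 0 0 := by
  have hs := Real.sqrt_pos.2 h
  rw [secondFormCoeff, profileSq_zero]
  have : r * (r + 0) - G (r ^ 2) * r ^ 2 * (r * ((r + 0) * (1 - t ^ 2) + t * (r * t + 0))) /
      (1 + G (r ^ 2) * r ^ 2) = r ^ 2 / (1 + G (r ^ 2) * r ^ 2) := by
    rw [eq_div_iff h.ne', sub_mul, div_mul_cancel₀ _ h.ne']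
    ring
  rw [this]
  positivity

lemma secondFormCoeffAxis_zero (G : ℝ → ℝ) (r t : ℝ) : secondFormCoeffAxis G r t 0 0 0 = 0 := by
  rw [secondFormCoeffAxis]
  ring

/-- For `a = b = c = 0` the axis coefficient is zero and the other one positive; continuity and
compactness of `[-1, 1]` preserve the inequality. It implies convexity because `⟪v, e⟫² ≤ ‖v‖²`. -/
lemma exists_small_convex (hr : 0 < r) (hO : IsOpen O) (hG : ContDiffOn ℝ ∞ G O)
    (hrO : r ^ 2 ∈ O) (h : 0 < 1 + G (r ^ 2) * r ^ 2) :
    ∃ η > 0, ∀ t ∈ Icc (-1 : ℝ) 1, ∀ a b c : ℝ, |a| ≤ η → |b| ≤ η → |c| ≤ η →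
      profileSq r t a ∈ O ∧ |secondFormCoeffAxis G r t a b c| < secondFormCoeff G r t a b := by
  have key : ∀ᶠ z in 𝓝 (0 : ℝ × ℝ × ℝ), ∀ t ∈ Icc (-1 : ℝ) 1, profileSq r t z.1 ∈ O ∧
      |secondFormCoeffAxis G r t z.1 z.2.1 z.2.2| < secondFormCoeff G r t z.1 z.2.1 := by
    refine isCompact_Icc.eventually_forall_of_forall_eventually
      (P := fun (z : ℝ × ℝ × ℝ) (t : ℝ) => profileSq r t z.1 ∈ O ∧
        |secondFormCoeffAxis G r t z.1 z.2.1 z.2.2| < secondFormCoeff G r t z.1 z.2.1)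
      fun t ht => ?_
    have hq : ContinuousAt (fun z : (ℝ × ℝ × ℝ) × ℝ => profileSq r z.2 z.1.1) (0, t) := by
      unfold profileSq
      fun_prop
    have hq0 : profileSq r t (0 : ℝ × ℝ × ℝ).1 = r ^ 2 := profileSq_zero r t
    have hGr : ContDiffAt ℝ ∞ G (r ^ 2) := hG.contDiffAt (hO.mem_nhds hrO)
    have hGc : ContinuousAt (fun z : (ℝ × ℝ × ℝ) × ℝ => G (profileSq r z.2 z.1.1)) (0, t) :=
      ContinuousAt.comp (g := G) (by rw [hq0]; exact hGr.continuousAt) hq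
    have hG'c : ContinuousAt (fun z : (ℝ × ℝ × ℝ) × ℝ => deriv G (profileSq r z.2 z.1.1)) (0, t) :=
      ContinuousAt.comp (g := deriv G) (by
        rw [hq0]
        exact ((hG.deriv_of_isOpen hO (m := 0) (by simp)).continuousOn.continuousAt
          (hO.mem_nhds hrO))) hq
    have hD := (continuousAt_const (y := (1 : ℝ))).add (hGc.mul hq)
    have hM : Continuous fun z : (ℝ × ℝ × ℝ) × ℝ =>
        r * ((r + z.1.2.1) * (1 - z.2 ^ 2) + z.2 * (r * z.2 + z.1.1)) := by fun_prop
    have hX : Continuous fun z : (ℝ × ℝ × ℝ) × ℝ =>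
        ((r * z.2 + z.1.1) * (r + z.1.2.1) - r ^ 2 * z.2) ^ 2 := by fun_prop
    have hb : Continuous fun z : (ℝ × ℝ × ℝ) × ℝ => r * (r + z.1.2.1) := by fun_prop
    have hc : Continuous fun z : (ℝ × ℝ × ℝ) × ℝ => -(r * z.2 * z.1.2.2) := by fun_prop
    have hne : 1 + G (profileSq r t (0 : ℝ × ℝ × ℝ).1) * profileSq r t (0 : ℝ × ℝ × ℝ).1 ≠ 0 := by
      rw [hq0]
      exact h.ne'
    have hA : ContinuousAt (fun z : (ℝ × ℝ × ℝ) × ℝ => secondFormCoeff G r z.2 z.1.1 z.1.2.1)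
        (0, t) :=
      (hD.sqrt.div_const r).mul (hb.continuousAt.sub
        (((hGc.mul continuousAt_const).mul hM.continuousAt).div hD hne))
    have hB : ContinuousAt (fun z : (ℝ × ℝ × ℝ) × ℝ =>
        |secondFormCoeffAxis G r z.2 z.1.1 z.1.2.1 z.1.2.2|) (0, t) :=
      ((hD.sqrt.div_const r).mul (hc.continuousAt.sub
        ((((hG'c.sub (hGc.pow 2)).mul hX.continuousAt).mul hM.continuousAt).div hD hne))).abs
    refine (hq.eventually_mem (hO.mem_nhds (by rw [hq0]; exact hrO))).and
      (hB.eventually_lt hA ?_)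
    simpa [secondFormCoeffAxis_zero] using secondFormCoeff_zero hr h t
  obtain ⟨ε, hε, hball⟩ := Metric.eventually_nhds_iff.1 key
  refine ⟨ε / 2, by positivity, fun t ht a b c ha hb hc => hball (y := (a, b, c)) ?_ t ht⟩
  rw [dist_zero_right]
  simp only [Prod.norm_def, Real.norm_eq_abs]
  exact max_lt (by linarith) (max_lt (by linarith) (by linarith))

/-- The Gauss equation at a pole: `1 / r²` is the intrinsic curvature and `G / (1 + G q)` the
ambient curvature of the tangent plane. The algebra does not depend on the dimension. -/
lemma secondFormCoeff_sq {t a b : ℝ} (hr : 0 < r) (ht : t ^ 2 = 1)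
    (h : 0 < 1 + G (profileSq r t a) * profileSq r t a) (hP : ProfileEq G r t a b) :
    secondFormCoeff G r t a b ^ 2 =
      r ^ 2 - r ^ 4 * (G (profileSq r t a) / (1 + G (profileSq r t a) * profileSq r t a)) := by
  have hq : profileSq r t a = (r * t + a) ^ 2 := by rw [profileSq, ht]; ring
  have hs := Real.sq_sqrt h.le
  rw [ProfileEq] at hP
  rw [secondFormCoeff]
  set c := G (profileSq r t a)
  set q := profileSq r t a
  set S := √(1 + c * q)
  have hX : (S / r * (r * (r + b) - c * r ^ 2 * (r * ((r + b) * (1 - t ^ 2) + t * (r * t + a))) /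
      (1 + c * q))) ^ 2 = S ^ 2 * ((r + b) - c * r ^ 2 * t * (r * t + a) / (1 + c * q)) ^ 2 := by
    rw [ht]
    field_simp
    ring
  rw [hX, hs]
  set u := c * r ^ 2 * t * (r * t + a) / (1 + c * q) with hu
  set k := c / (1 + c * q) with hk
  have h1 : u * (1 + c * q) = c * r ^ 2 * t * (r * t + a) := div_mul_cancel₀ _ h.ne'
  have h2 : u = k * r ^ 2 * t * (r * t + a) := by
    rw [hu, hk]
    ring
  have h3 : k * (1 + c * q) = c := div_mul_cancel₀ _ h.ne'
  have h4 : u * (c * r ^ 2 * t * (r * t + a)) = r ^ 4 * t ^ 2 * (c - k) := by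
    rw [h2]
    linear_combination k * c * r ^ 4 * t ^ 2 * (-hq) + r ^ 4 * t ^ 2 * h3
  linear_combination hP + (u - 2 * (r + b)) * h1 + h4 + c * (r + b) ^ 2 * hq - r ^ 4 * k * ht

end Small

/-! ### Isometric deformations of slice spheres -/

section Deformation

variable {m : ℕ} {f w : ℝ → ℝ} {I : Set ℝ} {r : ℝ} {e : E (m + 1)}

lemma axialMap_zero (r : ℝ) (e : E (m + 1)) :
    (fun p : Sph m => axialMap r (fun _ => 0) e p) = slice r := by
  funext p
  simp [axialMap, slice]

lemma axialNormal_zero (hr : 0 < r) (hfr : 0 < f r) (e : E (m + 1)) :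
    (fun p : Sph m => axialNormal (warpCoeff f) r (fun _ => 0) e p) = sliceNormal f r := by
  funext p
  have hY : axialMap r (fun _ => 0) e (p : E (m + 1)) = r • (p : E (m + 1)) := by simp [axialMap]
  have hN : axialConormal r (fun _ => 0) e (p : E (m + 1)) = r • (p : E (m + 1)) := by
    simp [axialConormal]
  have hn : ‖r • (p : E (m + 1))‖ ^ 2 = r ^ 2 := by
    rw [norm_smul, norm_coe_sphere, mul_one, Real.norm_eq_abs, sq_abs]
  have hD := one_add_warpCoeff_mul (f := f) (q := r ^ 2) (by positivity)
  rw [Real.sqrt_sq hr.le] at hD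
  rw [axialNormal, hY, hN, real_inner_self_eq_norm_sq, hn, hD, sliceNormal,
    show warpCoeff f (r ^ 2) * r ^ 2 = 1 / f r ^ 2 - 1 by linarith,
    Real.sqrt_div zero_le_one, Real.sqrt_one, Real.sqrt_sq hfr.le]
  match_scalars
  field_simp
  ring

lemma abs_inner_axis_le (he : ‖e‖ = 1) (p : Sph m) :
    ⟪(p : E (m + 1)), e⟫ ∈ Icc (-1 : ℝ) 1 := by
  have h := abs_real_inner_le_norm (p : E (m + 1)) e
  rw [norm_coe_sphere, he, mul_one] at h
  exact abs_le.1 h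

lemma abs_inner_axis_tangentVec_le (he : ‖e‖ = 1) (p : Sph m) (v : TangentSpace (𝓡 m) p) :
    ⟪tangentVec p v, e⟫ * ⟪tangentVec p v, e⟫ ≤ ⟪tangentVec p v, tangentVec p v⟫ := by
  have h := abs_real_inner_le_norm (tangentVec p v) e
  rw [he, mul_one] at h
  rw [real_inner_self_eq_norm_sq, ← sq, ← sq_abs]
  gcongr

/-- A profile function `w` that deforms the slice sphere of radius `r` isometrically into a
strictly convex hypersurface. -/
structure IsDeformation (I : Set ℝ) (f : ℝ → ℝ) (r : ℝ) (w : ℝ → ℝ) : Prop where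
  contDiff : ContDiff ℝ ∞ w
  abs_deriv_le : ∀ t, |deriv w t| ≤ r / 2
  profileEq : ∀ t ∈ Icc (-1 : ℝ) 1, ProfileEq (warpCoeff f) r t (w t) (deriv w t)
  mem : ∀ t ∈ Icc (-1 : ℝ) 1, profileSq r t (w t) ∈ squaredRadii I
  convex : ∀ t ∈ Icc (-1 : ℝ) 1,
    |secondFormCoeffAxis (warpCoeff f) r t (w t) (deriv w t) (deriv (deriv w) t)| <
      secondFormCoeff (warpCoeff f) r t (w t) (deriv w t)

section Geometry

variable (he : ‖e‖ = 1) (hw : IsDeformation I f r w)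
include he hw

lemma IsDeformation.axialMap_ne_zero (p : Sph m) : axialMap r w e (p : E (m + 1)) ≠ 0 := by
  have h := (hw.mem _ (abs_inner_axis_le he p)).1
  rw [← norm_axialMap_sq (norm_coe_sphere p) he] at h
  intro h0
  simp [h0] at h

lemma IsDeformation.eventually_warpedMetric (p : Sph m) :
    ∀ᶠ y in 𝓝 (axialMap r w e (p : E (m + 1))), warpedMetric f y = radialForm (warpCoeff f) y := by
  filter_upwards [isOpen_ne.mem_nhds (hw.axialMap_ne_zero he p)] with y hy
  exact warpedMetric_eq_radialForm hy

lemma IsDeformation.inducedMetric (p : Sph m) (u v : TangentSpace (𝓡 m) p) :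
    inducedMetric (warpedMetric f) (fun q : Sph m => axialMap r w e q) p u v =
      r ^ 2 * ⟪tangentVec p u, tangentVec p v⟫ :=
  inducedMetric_axialMap he hw.contDiff (hw.eventually_warpedMetric he p).self_of_nhds
    (hw.profileEq _ (abs_inner_axis_le he p)) u v

lemma IsDeformation.secondFundamentalForm (hf : IsWarpingFunction (m + 1) I f) (p : Sph m)
    (u v : TangentSpace (𝓡 m) p) :
    secondFundamentalForm (warpedMetric f) (fun q : Sph m => axialMap r w e q)
      (fun q : Sph m => axialNormal (warpCoeff f) r w e q) p u v =
      secondFormCoeff (warpCoeff f) r ⟪(p : E (m + 1)), e⟫ (w ⟪(p : E (m + 1)), e⟫)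
        (deriv w ⟪(p : E (m + 1)), e⟫) * ⟪tangentVec p u, tangentVec p v⟫
      + secondFormCoeffAxis (warpCoeff f) r ⟪(p : E (m + 1)), e⟫ (w ⟪(p : E (m + 1)), e⟫)
        (deriv w ⟪(p : E (m + 1)), e⟫) (deriv (deriv w) ⟪(p : E (m + 1)), e⟫) *
        (⟪tangentVec p u, e⟫ * ⟪tangentVec p v, e⟫) := by
  have ht := abs_inner_axis_le he p
  exact secondFundamentalForm_axialMap he hw.contDiff (hw.eventually_warpedMetric he p)
    ((hf.contDiffAt_warpCoeff (hw.mem _ ht)).of_le (by exact_mod_cast le_top))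
    (hf.one_add_warpCoeff_mul_pos (hw.mem _ ht)) (hw.profileEq _ ht) u v

theorem IsDeformation.isConvexHypersurface (hf : IsWarpingFunction (m + 1) I f) (hr : 0 < r) :
    IsConvexHypersurface (warpedMetric f) (region (m + 1) I)
      (fun q : Sph m => axialMap r w e q)
      (fun q : Sph m => axialNormal (warpCoeff f) r w e q) := by
  obtain ⟨hinj, Ω, hΩ, hΩb, hΩf, hout⟩ := exists_body he hr hw.contDiff hw.abs_deriv_le
  have hsq : ∀ p : Sph m, ‖axialMap r w e (p : E (m + 1))‖ ^ 2 ∈ squaredRadii I := fun p => by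
    rw [norm_axialMap_sq (norm_coe_sphere p) he]
    exact hw.mem _ (abs_inner_axis_le he p)
  have hpos := fun p => hf.one_add_warpCoeff_mul_pos (hsq p)
  have hunit : ∀ p : Sph m, radialForm (warpCoeff f) (axialMap r w e p)
      (axialNormal (warpCoeff f) r w e p) (axialNormal (warpCoeff f) r w e p) = 1 := fun p =>
    radialForm_axialNormal_self (norm_coe_sphere p) he hr
      (hf.one_add_warpCoeff_mul_pos (hw.mem _ (abs_inner_axis_le he p)))
      (hw.profileEq _ (abs_inner_axis_le he p))
  have htan : ∀ (p : Sph m) (v : TangentSpace (𝓡 m) p), v ≠ 0 →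
      0 < ⟪tangentVec p v, tangentVec p v⟫ := fun p v hv =>
    real_inner_self_pos.2 (tangentVec_ne_zero hv)
  constructor
  · intro p
    have := (hsq p).2
    rwa [Real.sqrt_sq (norm_nonneg _)] at this
  · exact (contDiff_axialMap hw.contDiff).contMDiff.comp (contMDiff_coe_sph m)
  · exact hinj.comp Subtype.val_injective
  · intro p
    refine (injective_iff_map_eq_zero _).2 fun v hv => ?_
    by_contra h0
    have h := hw.inducedMetric he p v v
    have h1 := htan p v h0
    rw [WarpedSpace.inducedMetric, hv,
      (hw.eventually_warpedMetric he p).self_of_nhds] at h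
    simp only [radialForm, inner_zero_right, mul_zero, add_zero] at h
    exact (mul_pos (pow_pos hr 2) h1).ne h
  · intro p
    exact (contDiffAt_axialNormal (N := ⊤) hw.contDiff (hf.contDiffAt_warpCoeff (hsq p))
      (hpos p)).contMDiffAt.comp p (contMDiff_coe_sph m p)
  · intro p
    rw [(hw.eventually_warpedMetric he p).self_of_nhds]
    exact hunit p
  · intro p v
    rw [(hw.eventually_warpedMetric he p).self_of_nhds, differential_axialMap hw.contDiff,
      radialForm_axialNormal (hpos p).ne', inner_axialConormal_tangent he (inner_tangentVec p v),
      mul_zero]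
  · refine ⟨Ω, hΩ, hΩb, hΩf, fun p => hout p _ ?_⟩
    have h := hunit p
    rw [radialForm_axialNormal (hpos p).ne'] at h
    exact pos_of_mul_pos_right (h ▸ one_pos) (by positivity)
  · intro p v hv
    rw [hw.secondFundamentalForm he hf]
    have hc := hw.convex _ (abs_inner_axis_le he p)
    have h1 := htan p v hv
    have h2 := abs_inner_axis_tangentVec_le he p v
    have h3 := mul_self_nonneg ⟪tangentVec p v, e⟫
    obtain ⟨h4, h5⟩ := abs_lt.1 hc
    nlinarith [mul_nonneg (abs_nonneg (secondFormCoeffAxis (warpCoeff f) r ⟪(p : E (m + 1)), e⟫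
        (w ⟪(p : E (m + 1)), e⟫) (deriv w ⟪(p : E (m + 1)), e⟫)
        (deriv (deriv w) ⟪(p : E (m + 1)), e⟫))) (sub_nonneg.2 h2), mul_pos (sub_pos.2 hc) h1,
      mul_nonneg (sub_nonneg.2 (neg_abs_le (secondFormCoeffAxis (warpCoeff f) r
        ⟪(p : E (m + 1)), e⟫ (w ⟪(p : E (m + 1)), e⟫) (deriv w ⟪(p : E (m + 1)), e⟫)
        (deriv (deriv w) ⟪(p : E (m + 1)), e⟫)))) h3]

end Geometry

/-- The slice as the trivial deformation, so that its fundamental forms come from the same formulas.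
-/
lemma isDeformation_zero (hf : IsWarpingFunction (m + 1) I f) (hrI : r ∈ I) (hr : 0 < r) :
    IsDeformation I f r fun _ => 0 where
  contDiff := contDiff_const
  abs_deriv_le t := by simpa using (half_pos hr).le
  profileEq t _ := by simpa using profileEq_zero _ r t
  mem t _ := by
    rw [profileSq_zero]
    exact sq_mem_squaredRadii hrI hr
  convex t _ := by
    simpa [secondFormCoeffAxis_zero] using secondFormCoeff_zero hr
      (hf.one_add_warpCoeff_mul_pos (sq_mem_squaredRadii hrI hr)) t

/-- If a deformed sphere has the second fundamental form of the slice sphere, then both poles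
lie at radii where the space has the same tangential sectional curvature. -/
theorem IsDeformation.curvature_eq (hm : 1 ≤ m) (hf : IsWarpingFunction (m + 1) I f) (hrI : r ∈ I)
    (hr : 0 < r) (he : ‖e‖ = 1) (hw : IsDeformation I f r w) (hlt : |w (-1)| < r)
    (hsame : SameSecondForm f r (fun q : Sph m => axialMap r w e q)
      (fun q : Sph m => axialNormal (warpCoeff f) r w e q)) :
    (f (r - w (-1)) ^ 2 - 1) / (r - w (-1)) ^ 2 = (f r ^ 2 - 1) / r ^ 2 := by
  have h0 := isDeformation_zero hf hrI hr
  have hfr := hf.pos r hrI hr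
  -- At this pole tangent vectors are orthogonal to `e`, so the axis term disappears, and with it
  -- `w''`.
  let p : Sph m := ⟨-e, by simp [he]⟩
  have hpe : ⟪(p : E (m + 1)), e⟫ = -1 := by
    simp [p, inner_neg_left, he]
  obtain ⟨v, hv⟩ : ∃ v : TangentSpace (𝓡 m) p, v ≠ 0 := by
    refine ⟨(EuclideanSpace.single (⟨0, hm⟩ : Fin m) (1 : ℝ) : EuclideanSpace ℝ (Fin m)), ?_⟩
    intro h
    have h' : (EuclideanSpace.single (⟨0, hm⟩ : Fin m) (1 : ℝ) : EuclideanSpace ℝ (Fin m)) = 0 := h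
    simp at h'
  have hve : ⟪tangentVec p v, e⟫ = 0 := by
    have := inner_tangentVec p v
    simp only [p, inner_neg_left, neg_eq_zero] at this
    rwa [real_inner_comm]
  have h1 := hsame p v v
  rw [← axialMap_zero r e, ← axialNormal_zero hr hfr e, hw.secondFundamentalForm he hf,
    h0.secondFundamentalForm he hf, hpe, hve] at h1
  simp only [mul_zero, add_zero, deriv_const] at h1
  have h2 := mul_right_cancel₀ (real_inner_self_pos.2 (tangentVec_ne_zero hv)).ne' h1
  have hmem : (-1 : ℝ) ∈ Icc (-1 : ℝ) 1 := by simp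
  have hA := secondFormCoeff_sq hr (by norm_num)
    (hf.one_add_warpCoeff_mul_pos (hw.mem _ hmem)) (hw.profileEq _ hmem)
  have hB := secondFormCoeff_sq (t := -1) hr (by norm_num)
    (hf.one_add_warpCoeff_mul_pos (h0.mem _ hmem)) (profileEq_zero _ r _)
  have hk : ∀ ρ, 0 < ρ → ρ ^ 2 ∈ squaredRadii I → warpCoeff f (ρ ^ 2) /
      (1 + warpCoeff f (ρ ^ 2) * ρ ^ 2) = -((f ρ ^ 2 - 1) / ρ ^ 2) := by
    intro ρ hρ hρI
    have h := hf.pos_sqrt hρI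
    rw [one_add_warpCoeff_mul hρI.1, warpCoeff]
    rw [Real.sqrt_sq hρ.le] at h ⊢
    field_simp
    ring
  have hq : profileSq r (-1) (w (-1)) = (r - w (-1)) ^ 2 := by
    rw [profileSq]
    ring
  have hq' : 0 < r - w (-1) := by linarith [(abs_lt.1 hlt).2]
  have hm1 := hw.mem _ hmem
  rw [hq] at hA hm1
  rw [h2, hB, profileSq_zero, hk r hr (sq_mem_squaredRadii hrI hr), hk _ hq' hm1] at hA
  have hr4 : r ^ 4 ≠ 0 := by positivity
  have h5 : r ^ 4 * ((f (r - w (-1)) ^ 2 - 1) / (r - w (-1)) ^ 2) =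
    r ^ 4 * ((f r ^ 2 - 1) / r ^ 2) := by linarith
  exact mul_left_cancel₀ hr4 h5

theorem exists_isometricPerturbation (hm : 1 ≤ m) (hf : IsWarpingFunction (m + 1) I f)
    (hrI : r ∈ I) (hr : 0 < r) (hcond : f r * deriv f r / r + (1 - f r ^ 2) / r ^ 2 ≠ 0)
    (k : ℕ) {δ : ℝ} (hδ : 0 < δ) :
    ∃ Y ν : Sph m → E (m + 1), IsIsometricPerturbation I f r k δ Y ν ∧ ¬ SameSecondForm f r Y ν := by
  set e : E (m + 1) := EuclideanSpace.single 0 1 with he_def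
  have he : ‖e‖ = 1 := by simp [he_def]
  have hr2 := sq_mem_squaredRadii hrI hr
  have hO := isOpen_squaredRadii hf.isOpen
  have hG := hf.contDiffOn_warpCoeff
  have hD := hf.one_add_warpCoeff_mul_pos hr2
  obtain ⟨η₁, hη₁, hclose⟩ := exists_ckClose (m := m) he r k hδ
  obtain ⟨η₂, hη₂, hconv⟩ := exists_small_convex hr hO hG hr2 hD
  obtain ⟨η₃, hη₃, hdom⟩ : ∃ η > 0, ∀ a : ℝ, |a| ≤ η → ∀ t ∈ Icc (-1 : ℝ) 1,
      (t, a) ∈ profileDomain (warpCoeff f) (squaredRadii I) r := by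
    have : ∀ᶠ a in 𝓝 (0 : ℝ), ∀ t ∈ Icc (-1 : ℝ) 1,
        (t, a) ∈ profileDomain (warpCoeff f) (squaredRadii I) r := by
      refine isCompact_Icc.eventually_forall_of_forall_eventually
        (P := fun a t => (t, a) ∈ profileDomain (warpCoeff f) (squaredRadii I) r) fun t ht => ?_
      have h1 : Tendsto (fun z : ℝ × ℝ => (z.2, z.1)) (𝓝 (0, t)) (𝓝 (t, 0)) :=
        (continuous_snd.prodMk continuous_fst).tendsto' _ _ rfl
      exact h1.eventually ((isOpen_profileDomain hO hG).mem_nhds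
        (mem_profileDomain_zero hr2 hD ht))
    obtain ⟨ε, hε, h⟩ := Metric.eventually_nhds_iff.1 this
    refine ⟨ε / 2, by positivity, fun a ha => h ?_⟩
    rw [dist_zero_right, Real.norm_eq_abs]
    linarith
  -- A function with nonzero derivative at `r` does not take its value at `r` again nearby.
  obtain ⟨η₄, hη₄, hcurv⟩ : ∃ η > 0, ∀ ρ : ℝ, |ρ - r| ≤ η → ρ ≠ r →
      (f ρ ^ 2 - 1) / ρ ^ 2 ≠ (f r ^ 2 - 1) / r ^ 2 := by
    have h := (hf.hasDerivAt_curvature hrI hr).eventually_ne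
      (c := (f r ^ 2 - 1) / r ^ 2) (mul_ne_zero (by positivity) hcond)
    rw [eventually_nhdsWithin_iff] at h
    obtain ⟨ε, hε, h⟩ := Metric.eventually_nhds_iff.1 h
    refine ⟨ε / 2, by positivity, fun ρ hρ hne => h ?_ hne⟩
    rw [Real.dist_eq]
    linarith
  -- The bounds serve closeness, convexity, the domain of the ODE and the change of curvature; `r /
  -- 2` gives both `|w'| ≤ r / 2` and `|w (-1)| < r`.
  set η := min (min η₁ η₂) (min (min η₃ η₄) (r / 2))
  have hηpos : 0 < η := by positivity
  have le1 : η ≤ η₁ := (min_le_left _ _).trans (min_le_left _ _)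
  have le2 : η ≤ η₂ := (min_le_left _ _).trans (min_le_right _ _)
  have le3 : η ≤ η₃ := (min_le_right _ _).trans ((min_le_left _ _).trans (min_le_left _ _))
  have le4 : η ≤ η₄ := (min_le_right _ _).trans ((min_le_left _ _).trans (min_le_right _ _))
  have le5 : η ≤ r / 2 := (min_le_right _ _).trans (min_le_right _ _)
  obtain ⟨w, hw, hw1, hwt, hwd⟩ := exists_small_solution
    (isOpen_profileDomain (r := r) hO hG) (contDiffOn_profileField hG)
    (fun t ht => profileField_zero ht) (fun t ht => mem_profileDomain_zero hr2 hD ht)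
    -- Convexity involves `w''`, so two derivatives are controlled even if `k < 2`.
    (max k 2) hηpos
  have hd1 : ∀ t, |deriv w t| ≤ η := fun t => by
    simpa using hwd 1 le_rfl ((by norm_num : 1 ≤ 2).trans (le_max_right _ _)) t
  have hd2 : ∀ t, |deriv (deriv w) t| ≤ η := fun t => by
    have := hwd 2 (by norm_num) (le_max_right _ _) t
    rwa [iteratedDeriv_succ, iteratedDeriv_one] at this
  have hdef : IsDeformation I f r w :=
    { contDiff := hw
      abs_deriv_le := fun t => (hd1 t).trans le5
      profileEq := fun t ht => by
        rw [(hwt t ht).2.deriv]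
        exact profileEq_profileField (hdom _ ((hwt t ht).1.trans le3) t ht)
      mem := fun t ht => (hconv t ht _ _ _ ((hwt t ht).1.trans le2) ((hd1 t).trans le2)
        ((hd2 t).trans le2)).1
      convex := fun t ht => (hconv t ht _ _ _ ((hwt t ht).1.trans le2) ((hd1 t).trans le2)
        ((hd2 t).trans le2)).2 }
  have h0 := isDeformation_zero hf hrI hr
  have hmem : (-1 : ℝ) ∈ Icc (-1 : ℝ) 1 := by simp
  refine ⟨_, _, ⟨hdef.isConvexHypersurface he hf hr, fun p u v => ?_, ?_⟩, fun hsame => ?_⟩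
  · rw [hdef.inducedMetric he, ← axialMap_zero r e, h0.inducedMetric he]
  · refine hclose w hw fun j hj t ht => ?_
    rcases Nat.eq_zero_or_pos j with rfl | hj0
    · simpa using (hwt t ht).1.trans le1
    · exact (hwd j hj0 (hj.trans (le_max_left _ _)) t).trans le1
  · have ha := (hwt _ hmem).1
    refine hcurv (r - w (-1)) ?_ ?_ (hdef.curvature_eq hm hf hrI hr he
      (ha.trans_lt (by linarith)) hsame)
    · rw [sub_sub_cancel_left, abs_neg]
      exact ha.trans le4
    · intro h
      exact hw1 (by linarith)

end Deformation

/-! ### Spaces with rigid slice spheres -/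

section Rigid

variable {n : ℕ} {f : ℝ → ℝ} {I : Set ℝ}

/-- The derivative of `(f² - 1)/ρ²` vanishes on the interval `I ∩ (0, ∞)`, which is connected. -/
lemma IsWarpingFunction.exists_curvature (hf : IsWarpingFunction n I f)
    (h : ∀ r ∈ I, 0 < r → f r * deriv f r / r + (1 - f r ^ 2) / r ^ 2 = 0) :
    ∃ κ : ℝ, ∀ r ∈ I, 0 < r → f r ^ 2 = 1 + κ * r ^ 2 := by
  have hd : ∀ r ∈ I ∩ Ioi 0, HasDerivAt (fun ρ => (f ρ ^ 2 - 1) / ρ ^ 2) 0 r := by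
    rintro r ⟨hr, hr0⟩
    simpa [h r hr hr0] using hf.hasDerivAt_curvature hr hr0
  obtain ⟨κ, hκ⟩ := (hf.isOpen.inter isOpen_Ioi).exists_is_const_of_deriv_eq_zero
    (hf.ordConnected.inter ordConnected_Ioi).isPreconnected
    (fun r hr => (hd r hr).differentiableAt.differentiableWithinAt) fun r hr => (hd r hr).deriv
  refine ⟨κ, fun r hr hr0 => ?_⟩
  have := hκ r ⟨hr, hr0⟩
  rw [div_eq_iff (by positivity)] at this
  linarith

theorem IsWarpingFunction.hasConstantSectionalCurvature (hf : IsWarpingFunction n I f) {κ : ℝ}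
    (h : ∀ r ∈ I, 0 < r → f r ^ 2 = 1 + κ * r ^ 2) :
    HasConstantSectionalCurvature (warpedMetric f : FormField n) (region n I) (-κ) := by
  have hpos : ∀ x ∈ region n I, 1 + κ * ‖x‖ ^ 2 ≠ 0 := by
    intro x hx
    rcases eq_or_ne x 0 with rfl | hx0
    · simp
    · have hn := norm_pos_iff.2 hx0
      rw [← h _ hx hn]
      exact (pow_pos (hf.pos _ hx hn) 2).ne'
  refine hasConstantSectionalCurvature_spaceForm (hf.isOpen.preimage continuous_norm) ?_ hpos
  intro x hx
  -- At the origin both forms are the Euclidean inner product, whatever the coefficient.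
  rcases eq_or_ne x 0 with rfl | hx0
  · funext v w
    simp [warpedMetric, radialForm]
  · have hn := norm_pos_iff.2 hx0
    have h1 := hpos x hx
    have h2 : warpCoeff f (‖x‖ ^ 2) = spaceFormCoeff κ (‖x‖ ^ 2) := by
      rw [warpCoeff, spaceFormCoeff, Real.sqrt_sq hn.le, h _ hx hn]
      field_simp
      ring
    rw [warpedMetric_eq_radialForm hx0]
    funext v w
    rw [radialForm, radialForm, h2]

end Rigid

end WarpedSpace

end

theorem mainTheorem4 (m : ℕ) (hm : 1 ≤ m) (I : Set ℝ) (f : ℝ → ℝ)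
    (hf : WarpedSpace.IsWarpingFunction (m + 1) I f) :
    (∀ r ∈ I, 0 < r → f r * deriv f r / r + (1 - f r ^ 2) / r ^ 2 ≠ 0 →
      ¬ WarpedSpace.SphereIsRigid m I f r ∧
      ∀ (k : ℕ) (δ : ℝ), 0 < δ →
        ∃ Y ν : WarpedSpace.Sph m → WarpedSpace.E (m + 1),
          WarpedSpace.IsIsometricPerturbation I f r k δ Y ν ∧
          ¬ WarpedSpace.SameSecondForm f r Y ν) ∧
    ((∀ r ∈ I, 0 < r → WarpedSpace.SphereIsRigid m I f r) →
      ∃ κ : ℝ, (∀ r ∈ I, 0 < r → f r = Real.sqrt (1 + κ * r ^ 2)) ∧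
        WarpedSpace.HasConstantSectionalCurvature (WarpedSpace.warpedMetric f)
          (WarpedSpace.region (m + 1) I) (-κ)) := by
  have hnot : ∀ r ∈ I, 0 < r → f r * deriv f r / r + (1 - f r ^ 2) / r ^ 2 ≠ 0 →
      ¬ WarpedSpace.SphereIsRigid m I f r := by
    rintro r hrI hr hcond ⟨k, δ, hδ, h⟩
    obtain ⟨Y, ν, hY, hne⟩ :=
      WarpedSpace.exists_isometricPerturbation hm hf hrI hr hcond k hδ
    exact hne (h Y ν hY)
  refine ⟨fun r hrI hr hcond => ⟨hnot r hrI hr hcond, fun k δ hδ =>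
    WarpedSpace.exists_isometricPerturbation hm hf hrI hr hcond k hδ⟩, fun hrigid => ?_⟩
  obtain ⟨κ, hκ⟩ := hf.exists_curvature fun r hrI hr => by
    by_contra hcond
    exact hnot r hrI hr hcond (hrigid r hrI hr)
  refine ⟨κ, fun r hrI hr => ?_, hf.hasConstantSectionalCurvature hκ⟩
  rw [← hκ r hrI hr, Real.sqrt_sq (hf.pos r hrI hr).le]
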